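/- Let $N \ge 1$ be an integer, $s \in (0,1)$, $1 < p < N/s$, $p_s^\ast = Np/(N-sp)$ and $p < q < p_s^\ast$. For a measurable function $u : \mathbb{R}^N \to \mathbb{R}$ let $$[u]_{s,p} = \left(\int_{\mathbb{R}^{2N}} \frac{|u(x)-u(y)|^p}{|x-y|^{N+sp}}\,dx\,dy\right)^{1/p},$$ and let $D^{s,p}(\mathbb{R}^N) = \{u \in L^{p_s^\ast}(\mathbb{R}^N) : [u]_{s,p} < \infty\}$ be the homogeneous fractional Sobolev space, with the norm $\|u\| = [u]_{s,p}$. Let $a, b : \mathbb{R}^N \to \mathbb{R}$ be measurable functions such that, for some $\alpha, \beta > 0$ and $c_a, c_b \ge 0$, $$0 \le a(x) \le \frac{c_a}{1+|x|^{N+\alpha}}, \qquad 0 \le b(x) \le \frac{c_b}{1+|x|^{N+\beta}} \qquad \text{for a.a. } x \in \mathbb{R}^N,$$ and let $\lambda, \mu \ge 0$. Consider the functional $$E(u) = \frac1p \int_{\mathbb{R}^{2N}} \frac{|u(x)-u(y)|^p}{|x-y|^{N+sp}}\,dx\,dy - \frac{\lambda}{p}\int_{\mathbb{R}^N} a(x)|u|^p\,dx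 - \frac{\mu}{q}\int_{\mathbb{R}^N} b(x)|u|^q\,dx - \frac{1}{p_s^\ast}\int_{\mathbb{R}^N} |u|^{p_s^\ast}\,dx, \qquad u \in D^{s,p}(\mathbb{R}^N),$$ and the best fractional Sobolev constant $$S = \inf_{u \in D^{s,p}(\mathbb{R}^N)\setminus\{0\}} \frac{[u]_{s,p}^p}{|u|_{p_s^\ast}^p},$$ where $|\cdot|_{p_s^\ast}$ is the norm of $L^{p_s^\ast}(\mathbb{R}^N)$. Then $E$ satisfies the Palais–Smale condition at every level $c \in \mathbb{R}$ with $$c < \frac{s}{N}\, S^{N/(sp)},$$ that is, every sequence $(u_j)$ in $D^{s,p}(\mathbb{R}^N)$ such that $E(u_j) \to c$ and $E'(u_j) \to 0$ in the dual space of $D^{s,p}(\mathbb{R}^N)$, where $E'$ is the Fréchet derivative of $E$, has a subsequence that converges strongly in $D^{s,p}(\mathbb{R}^N)$. -/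

import Mathlib

open MeasureTheory Filter Topology
open scoped ENNReal

noncomputable section

namespace FracSobolev

/-- The Euclidean space `ℝ^N`. -/
abbrev Space (N : ℕ) : Type := EuclideanSpace ℝ (Fin N)

/-- The fractional critical Sobolev exponent `p_s^* = N p / (N - s p)`. -/
def critExp (N : ℕ) (s p : ℝ) : ℝ := N * p / (N - s * p)

/-- The integrand `|u(x) - u(y)|^p / |x - y|^(N + s p)` at the point `z = (x, y)`. -/
def gagliardoIntegrand {N : ℕ} (s p : ℝ) (u : Space N → ℝ) (z : Space N × Space N) : ℝ :=
  |u z.1 - u z.2| ^ p / ‖z.1 - z.2‖ ^ ((N : ℝ) + s * p)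

/-- The `p`-th power of the Gagliardo seminorm, a number in `[0, ∞]`. -/
def gagliardoLIntegral {N : ℕ} (s p : ℝ) (u : Space N → ℝ) : ℝ≥0∞ :=
  ∫⁻ z : Space N × Space N, ENNReal.ofReal (gagliardoIntegrand s p u z)

/-- The Lebesgue space `L^{p_s^*}(ℝ^N)` (functions modulo equality almost everywhere). -/
abbrev CritLp (N : ℕ) (s p : ℝ) : Type :=
  ↥(Lp ℝ (ENNReal.ofReal (critExp N s p)) (volume : Measure (Space N)))

/-! ### Auxiliary facts: the Gagliardo seminorm as the `L^p` norm of a difference quotient -/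

/-- The difference quotient whose `L^p` norm is the Gagliardo seminorm. -/
def diffQuot {N : ℕ} (s p : ℝ) (u : Space N → ℝ) (z : Space N × Space N) : ℝ :=
  (u z.1 - u z.2) / ‖z.1 - z.2‖ ^ (((N : ℝ) + s * p) / p)

theorem enorm_diffQuot_rpow {N : ℕ} (s : ℝ) {p : ℝ} (hp : 0 < p) (u : Space N → ℝ)
    (z : Space N × Space N) :
    ‖diffQuot s p u z‖ₑ ^ p = ENNReal.ofReal (gagliardoIntegrand s p u z) := by
  rw [← ofReal_norm, ENNReal.ofReal_rpow_of_nonneg (norm_nonneg _) hp.le]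
  congr 1
  have h0 : (0 : ℝ) ≤ ‖z.1 - z.2‖ := norm_nonneg _
  rw [diffQuot, gagliardoIntegrand, Real.norm_eq_abs, abs_div,
    abs_of_nonneg (Real.rpow_nonneg h0 _), Real.div_rpow (abs_nonneg _) (Real.rpow_nonneg h0 _),
    ← Real.rpow_mul h0, div_mul_cancel₀ _ hp.ne']

theorem eLpNorm_diffQuot {N : ℕ} (s : ℝ) {p : ℝ} (hp : 0 < p) (u : Space N → ℝ) :
    eLpNorm (diffQuot s p u) (ENNReal.ofReal p) volume = gagliardoLIntegral s p u ^ (1 / p) := by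
  rw [eLpNorm_eq_lintegral_rpow_enorm_toReal (by simpa using hp) ENNReal.ofReal_ne_top,
    ENNReal.toReal_ofReal hp.le, gagliardoLIntegral]
  simp_rw [enorm_diffQuot_rpow s hp]

theorem diffQuot_congr {N : ℕ} (s p : ℝ) {u v : Space N → ℝ} (h : u =ᵐ[volume] v) :
    diffQuot s p u =ᵐ[volume] diffQuot s p v := by
  have h1 := (Measure.quasiMeasurePreserving_fst
    (μ := (volume : Measure (Space N))) (ν := (volume : Measure (Space N)))).ae h
  have h2 := (Measure.quasiMeasurePreserving_snd
    (μ := (volume : Measure (Space N))) (ν := (volume : Measure (Space N)))).ae h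
  filter_upwards [h1, h2] with z hz1 hz2
  simp only [diffQuot, hz1, hz2]

theorem aestronglyMeasurable_diffQuot {N : ℕ} (s p : ℝ) {u : Space N → ℝ}
    (h : AEStronglyMeasurable u volume) : AEStronglyMeasurable (diffQuot s p u) volume := by
  have h1 := h.comp_quasiMeasurePreserving (Measure.quasiMeasurePreserving_fst
    (μ := (volume : Measure (Space N))) (ν := (volume : Measure (Space N))))
  have h2 := h.comp_quasiMeasurePreserving (Measure.quasiMeasurePreserving_snd
    (μ := (volume : Measure (Space N))) (ν := (volume : Measure (Space N))))
  have h3 : Measurable fun z : Space N × Space N =>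
      ‖z.1 - z.2‖ ^ (((N : ℝ) + s * p) / p) := by fun_prop
  exact ((h1.sub h2).aemeasurable.div h3.aemeasurable).aestronglyMeasurable

theorem memLp_diffQuot_iff {N : ℕ} (s : ℝ) {p : ℝ} (hp : 0 < p) {u : Space N → ℝ}
    (h : AEStronglyMeasurable u volume) :
    MemLp (diffQuot s p u) (ENNReal.ofReal p) volume ↔ gagliardoLIntegral s p u < ∞ := by
  rw [MemLp, eLpNorm_diffQuot s hp, ENNReal.rpow_lt_top_iff_of_pos (by positivity)]
  exact and_iff_right (aestronglyMeasurable_diffQuot s p h)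

theorem diffQuot_add {N : ℕ} (s p : ℝ) (u v : Space N → ℝ) :
    diffQuot s p (u + v) = diffQuot s p u + diffQuot s p v := by
  ext z; simp only [diffQuot, Pi.add_apply]; ring

theorem diffQuot_smul {N : ℕ} (s p k : ℝ) (u : Space N → ℝ) :
    diffQuot s p (k • u) = k • diffQuot s p u := by
  ext z; simp only [diffQuot, Pi.smul_apply, smul_eq_mul]; ring

theorem diffQuot_zero {N : ℕ} (s p : ℝ) : diffQuot s p (0 : Space N → ℝ) = 0 := by
  ext z; simp [diffQuot]

/-! ### The homogeneous fractional Sobolev space -/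

theorem exp_pos (N : ℕ) (s p : ℝ) [hp : Fact (p ∈ Set.Ioo 1 ((N : ℝ) / s))] : 0 < p :=
  one_pos.trans hp.out.1

/-- The set `{u ∈ L^{p_s^*}(ℝ^N) : [u]_{s,p} < ∞}` as a subspace of `L^{p_s^*}(ℝ^N)`. -/
def homSobolevSubmodule (N : ℕ) (s p : ℝ) [Fact (p ∈ Set.Ioo 1 ((N : ℝ) / s))] :
    Submodule ℝ (CritLp N s p) where
  carrier := {u | gagliardoLIntegral s p u < ∞}
  zero_mem' := by
    have hp := exp_pos N s p
    rw [Set.mem_ofPred_eq, ← memLp_diffQuot_iff s hp (Lp.aestronglyMeasurable _),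
      memLp_congr_ae (diffQuot_congr s p (Lp.coeFn_zero _ _ _)), diffQuot_zero]
    exact MemLp.zero'
  add_mem' := by
    intro u v hu hv
    have hp := exp_pos N s p
    rw [Set.mem_ofPred_eq, ← memLp_diffQuot_iff s hp (Lp.aestronglyMeasurable _)] at hu hv ⊢
    rw [memLp_congr_ae (diffQuot_congr s p (Lp.coeFn_add u v)), diffQuot_add]
    exact hu.add hv
  smul_mem' := by
    intro k u hu
    have hp := exp_pos N s p
    rw [Set.mem_ofPred_eq, ← memLp_diffQuot_iff s hp (Lp.aestronglyMeasurable _)] at hu ⊢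
    rw [memLp_congr_ae (diffQuot_congr s p (Lp.coeFn_smul k u)), diffQuot_smul]
    exact hu.const_smul k

/-- The homogeneous fractional Sobolev space `D^{s,p}(ℝ^N)`. It is a type of its own, because its
norm is the Gagliardo seminorm and not the norm of `L^{p_s^*}(ℝ^N)`. -/
def HomSobolev (N : ℕ) (s p : ℝ) [Fact (p ∈ Set.Ioo 1 ((N : ℝ) / s))] : Type :=
  ↥(homSobolevSubmodule N s p)

section

variable (N : ℕ) (s p : ℝ) [Fact (p ∈ Set.Ioo 1 ((N : ℝ) / s))]

instance : AddCommGroup (HomSobolev N s p) :=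
  inferInstanceAs (AddCommGroup ↥(homSobolevSubmodule N s p))

instance : Module ℝ (HomSobolev N s p) :=
  inferInstanceAs (Module ℝ ↥(homSobolevSubmodule N s p))

/-- The inclusion of `D^{s,p}(ℝ^N)` in `L^{p_s^*}(ℝ^N)`. -/
def toLp : HomSobolev N s p →ₗ[ℝ] CritLp N s p := (homSobolevSubmodule N s p).subtype

/-- Elements of `D^{s,p}(ℝ^N)` are used as functions on `ℝ^N` (defined almost everywhere). -/
instance : CoeFun (HomSobolev N s p) (fun _ => Space N → ℝ) := ⟨fun u => toLp N s p u⟩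

/-- The norm `‖u‖ = [u]_{s,p}` of `D^{s,p}(ℝ^N)`. -/
instance : Norm (HomSobolev N s p) := ⟨fun u => (gagliardoLIntegral s p u).toReal ^ (1 / p)⟩

end

section

variable {N : ℕ} {s p : ℝ} [hp : Fact (p ∈ Set.Ioo 1 ((N : ℝ) / s))]

theorem norm_def (u : HomSobolev N s p) :
    ‖u‖ = (gagliardoLIntegral s p u).toReal ^ (1 / p) := rfl

theorem gagliardo_lt_top (u : HomSobolev N s p) : gagliardoLIntegral s p u < ∞ := u.2

theorem toLp_injective : Function.Injective (toLp N s p) := Subtype.val_injective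

theorem memLp_diffQuot (u : HomSobolev N s p) :
    MemLp (diffQuot s p u) (ENNReal.ofReal p) volume :=
  (memLp_diffQuot_iff s (exp_pos N s p) (Lp.aestronglyMeasurable _)).2 (gagliardo_lt_top u)

theorem norm_eq_eLpNorm (u : HomSobolev N s p) :
    ‖u‖ = (eLpNorm (diffQuot s p u) (ENNReal.ofReal p) volume).toReal := by
  rw [norm_def, eLpNorm_diffQuot s (exp_pos N s p), ENNReal.toReal_rpow]

theorem coe_add (u v : HomSobolev N s p) :
    ⇑(toLp N s p (u + v)) =ᵐ[volume] ⇑(toLp N s p u) + ⇑(toLp N s p v) := by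
  rw [map_add]; exact Lp.coeFn_add _ _

theorem coe_smul (k : ℝ) (u : HomSobolev N s p) :
    ⇑(toLp N s p (k • u)) =ᵐ[volume] k • ⇑(toLp N s p u) := by
  rw [map_smul]; exact Lp.coeFn_smul _ _

theorem norm_add_le' (u v : HomSobolev N s p) : ‖u + v‖ ≤ ‖u‖ + ‖v‖ := by
  have h1 : (1 : ℝ≥0∞) ≤ ENNReal.ofReal p := by
    simpa using ENNReal.ofReal_le_ofReal hp.out.1.le
  simp only [norm_eq_eLpNorm]
  rw [← ENNReal.toReal_add (memLp_diffQuot u).2.ne (memLp_diffQuot v).2.ne,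
    eLpNorm_congr_ae (diffQuot_congr s p (coe_add u v)), diffQuot_add]
  exact ENNReal.toReal_mono
    (ENNReal.add_ne_top.2 ⟨(memLp_diffQuot u).2.ne, (memLp_diffQuot v).2.ne⟩)
    (eLpNorm_add_le (memLp_diffQuot u).1 (memLp_diffQuot v).1 h1)

theorem norm_smul' (k : ℝ) (u : HomSobolev N s p) : ‖k • u‖ = ‖k‖ * ‖u‖ := by
  simp only [norm_eq_eLpNorm]
  rw [eLpNorm_congr_ae (diffQuot_congr s p (coe_smul k u)), diffQuot_smul, eLpNorm_const_smul,
    ENNReal.toReal_mul, toReal_enorm]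

theorem eq_zero_of_norm_eq_zero [hs : Fact (s ∈ Set.Ioo (0 : ℝ) 1)] (u : HomSobolev N s p)
    (h : ‖u‖ = 0) : u = 0 := by
  have hs0 := hs.out.1
  have hp0 := exp_pos N s p
  have hsp : s * p < N := by
    have h2 := (lt_div_iff₀ hs0).1 hp.out.2
    linarith
  have hN : (0 : ℝ) < N := (mul_pos hs0 hp0).trans hsp
  have hN' : 0 < N := by exact_mod_cast hN
  have hcrit : 0 < critExp N s p := div_pos (mul_pos hN hp0) (sub_pos.2 hsp)
  have : Nonempty (Fin N) := ⟨⟨0, hN'⟩⟩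
  rw [norm_eq_eLpNorm, ENNReal.toReal_eq_zero_iff, or_iff_left (memLp_diffQuot u).2.ne,
    eLpNorm_eq_zero_iff (memLp_diffQuot u).1 (by simpa using hp0)] at h
  have h1 : ∀ᵐ z : Space N × Space N ∂((volume : Measure (Space N)).prod volume),
      u z.1 = u z.2 := by
    rw [← Measure.volume_eq_prod]
    filter_upwards [h] with z hz
    rcases div_eq_zero_iff.1 hz with h3 | h3
    · exact sub_eq_zero.1 h3
    · have h4 := ((Real.rpow_eq_zero_iff_of_nonneg (norm_nonneg _)).1 h3).1
      rw [sub_eq_zero.1 (norm_eq_zero.1 h4)]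
  obtain ⟨x, hx⟩ := (Measure.ae_ae_of_ae_prod h1).exists
  have h2 : ⇑(toLp N s p u) =ᵐ[volume] fun _ => u x := by
    filter_upwards [hx] with y hy using hy.symm
  have h3 := (memLp_congr_ae h2).1 (Lp.memLp (toLp N s p u))
  rw [memLp_const_iff (by simpa using hcrit) ENNReal.ofReal_ne_top] at h3
  have h4 : u x = 0 := by
    rcases h3 with h3 | h3
    · exact h3
    · rw [measure_univ_of_isAddLeftInvariant] at h3
      exact absurd h3 (lt_irrefl _)
  apply toLp_injective
  rw [map_zero]
  refine Lp.ext ?_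
  filter_upwards [h2, Lp.coeFn_zero ℝ (ENNReal.ofReal (critExp N s p))
    (volume : Measure (Space N))] with y hy hy0
  rw [hy, h4, hy0, Pi.zero_apply]

end

section

variable (N : ℕ) (s p : ℝ) [Fact (s ∈ Set.Ioo (0 : ℝ) 1)] [Fact (p ∈ Set.Ioo 1 ((N : ℝ) / s))]

theorem normedSpaceCore : NormedSpace.Core ℝ (HomSobolev N s p) where
  norm_nonneg u := by rw [norm_eq_eLpNorm]; exact ENNReal.toReal_nonneg
  norm_smul k u := norm_smul' k u
  norm_triangle u v := norm_add_le' u v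
  norm_eq_zero_iff u := ⟨eq_zero_of_norm_eq_zero u, by
    rintro rfl
    simpa using norm_smul' (0 : ℝ) (0 : HomSobolev N s p)⟩

instance : NormedAddCommGroup (HomSobolev N s p) := NormedAddCommGroup.ofCore (normedSpaceCore N s p)

instance : NormedSpace ℝ (HomSobolev N s p) := NormedSpace.ofCore (normedSpaceCore N s p)

/-- The best fractional Sobolev constant
`S = inf { [u]_{s,p}^p / |u|_{p_s^*}^p : u ∈ D^{s,p}(ℝ^N) \ {0} }`. -/
def sobolevConst : ℝ :=
  ⨅ u : {u : HomSobolev N s p // u ≠ 0}, ‖u.1‖ ^ p / ‖toLp N s p u.1‖ ^ p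

/-- The energy functional `E` on `D^{s,p}(ℝ^N)` with parameters `lam`, `mu` (the numbers `λ`, `μ`),
weights `a`, `b` and subcritical exponent `q`. -/
def energy (q lam mu : ℝ) (a b : Space N → ℝ) (u : HomSobolev N s p) : ℝ :=
  1 / p * (∫ z : Space N × Space N, gagliardoIntegrand s p u z)
    - lam / p * (∫ x : Space N, a x * |u x| ^ p)
    - mu / q * (∫ x : Space N, b x * |u x| ^ q)
    - 1 / critExp N s p * (∫ x : Space N, |u x| ^ critExp N s p)

end

/-- The Palais-Smale condition at the level `c` for a functional `E` on a normed space `W`: every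
sequence with `E(u_j) → c` and `E'(u_j) → 0` in the dual space (`E'` is the Fréchet derivative) has
a strongly convergent subsequence. -/
def PalaisSmale {W : Type*} [NormedAddCommGroup W] [NormedSpace ℝ W] (E : W → ℝ) (c : ℝ) : Prop :=
  ∀ u : ℕ → W,
    Tendsto (fun j => E (u j)) atTop (𝓝 c) →
    Tendsto (fun j => fderiv ℝ E (u j)) atTop (𝓝 0) →
    ∃ φ : ℕ → ℕ, StrictMono φ ∧ ∃ w : W, Tendsto (fun j => u (φ j)) atTop (𝓝 w)

end FracSobolev

end

/-! The energy is a combination of powers of norms of bounded linear images of `u`: the difference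
quotient in `L^p(ℝ^{2N})`, the weighted functions `a^{1/p} u` and `b^{1/q} u`, and `u` in the
critical space. Differentiability and limits thus reduce to the functional `f ↦ ‖f‖ ^ r` on `L^r`
(`hasFDerivAt_norm_rpow_Lp`).

Let `(u_j)` be a Palais–Smale sequence. In `E(u_j) - E'(u_j)u_j / q` the `b`-term cancels and the
critical term has a positive coefficient that absorbs the `a`-term, so `(u_j)` is bounded
(`exists_bound_of_energy`). A subsequence converges almost everywhere to some `w` in the space. The
weighted integrals converge, because the weights are bounded and integrable and the powers
subcritical; moreover `E'(u_j)w → E'(w)w`, so `E'(w)w = 0`. The Brezis–Lieb lemma splits the two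
other terms, and `‖u_j - w‖^p` and `|u_j - w|^{p_s^*}` (integrated) tend to one number `l` with `c =
E(w) + (s/N) l`. Since `E(w) = E(w) - E'(w)w / p ≥ 0`, the level bound gives `l < S^{N/(sp)}`, and
the definition of `S` then forces `l = 0`.

Sobolev's inequality and almost everywhere compactness both come from comparing `u(x)` with the mean
of `u` over the grid cell of side `r` containing `x`: the difference is controlled by the Gagliardo
seminorm, the mean by the critical norm. Optimising in `r` gives the inequality; letting `r → 0`
gives compactness. -/

noncomputable section

namespace FracSobolev

/-! ### Elementary inequalities for powers -/

/-- The function `t ↦ |t|^(r-2) t`. -/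
def signedPow (r t : ℝ) : ℝ := |t| ^ (r - 2) * t

theorem signedPow_mul_self {r : ℝ} (hr : 0 < r) (t : ℝ) : signedPow r t * t = |t| ^ r := by
  rcases eq_or_ne t 0 with rfl | ht
  · simp [Real.zero_rpow hr.ne']
  · have h : 0 < |t| := abs_pos.2 ht
    rw [signedPow, mul_assoc, ← sq, ← sq_abs, ← Real.rpow_natCast, ← Real.rpow_add h]
    norm_num

theorem abs_signedPow {r : ℝ} (hr : 1 < r) (t : ℝ) : |signedPow r t| = |t| ^ (r - 1) := by
  rcases eq_or_ne t 0 with rfl | ht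
  · simp [signedPow, Real.zero_rpow (sub_pos.2 hr).ne']
  · have h : 0 < |t| := abs_pos.2 ht
    rw [signedPow, abs_mul, abs_of_nonneg (by positivity)]
    nth_rewrite 2 [← Real.rpow_one |t|]
    rw [← Real.rpow_add h]
    ring_nf

theorem continuous_signedPow {r : ℝ} (hr : 1 < r) : Continuous (signedPow r) := by
  rw [continuous_iff_continuousAt]
  intro t
  rcases eq_or_ne t 0 with rfl | ht
  · have h0 : signedPow r 0 = 0 := by simp [signedPow]
    rw [ContinuousAt, h0, tendsto_zero_iff_norm_tendsto_zero]
    simp_rw [Real.norm_eq_abs, abs_signedPow hr]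
    have : Continuous fun t : ℝ => |t| ^ (r - 1) :=
      continuous_abs.rpow_const fun _ => Or.inr (sub_pos.2 hr).le
    simpa [Real.zero_rpow (sub_pos.2 hr).ne'] using this.tendsto 0
  · exact (continuousAt_id.abs.rpow_const (Or.inl (abs_pos.2 ht).ne')).mul continuousAt_id

theorem exists_rpow_le_add {r m ε : ℝ} (hr : 0 < r) (hrm : r < m) (hε : 0 < ε) :
    ∃ C, 0 ≤ C ∧ ∀ t, 0 ≤ t → t ^ r ≤ ε * t ^ m + C := by
  -- `K` solves `ε * K ^ (m - r) = 1`: above it the higher power wins, below it `K ^ r` is a bound.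
  set K : ℝ := (1 / ε) ^ (1 / (m - r)) with hK
  have hK0 : 0 < K := by positivity
  refine ⟨K ^ r, by positivity, fun t ht => ?_⟩
  rcases le_total t K with h | h
  · have := Real.rpow_le_rpow ht h hr.le
    have : 0 ≤ ε * t ^ m := by positivity
    linarith
  · have ht0 : 0 < t := hK0.trans_le h
    have h1 : 1 / ε ≤ t ^ (m - r) := by
      have := Real.rpow_le_rpow hK0.le h (sub_pos.2 hrm).le
      rwa [hK, ← Real.rpow_mul (by positivity), one_div_mul_cancel (sub_pos.2 hrm).ne',
        Real.rpow_one] at this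
    have h2 : t ^ m = t ^ r * t ^ (m - r) := by rw [← Real.rpow_add ht0]; ring_nf
    have h3 : 1 ≤ ε * t ^ (m - r) := by rwa [div_le_iff₀' hε] at h1
    have h4 : 0 ≤ K ^ r := by positivity
    have h5 : 0 < t ^ r := by positivity
    rw [h2]
    nlinarith

/-- Young's inequality without a sharp constant: either `y ≤ η x` or `x ≤ y / η`, and in each case
one of the two terms on the right suffices. -/
theorem exists_rpow_sub_one_mul_le {r η : ℝ} (hr : 1 < r) (hη : 0 < η) :
    ∃ C, 0 ≤ C ∧ ∀ x y, 0 ≤ x → 0 ≤ y → x ^ (r - 1) * y ≤ η * x ^ r + C * y ^ r := by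
  have key : ∀ z : ℝ, 0 ≤ z → z ^ r = z ^ (r - 1) * z := fun z hz => by
    rcases hz.eq_or_lt with rfl | hz
    · rw [mul_zero, Real.zero_rpow (by linarith)]
    · nth_rewrite 3 [← Real.rpow_one z]
      rw [← Real.rpow_add hz]; ring_nf
  refine ⟨(1 / η) ^ (r - 1), by positivity, fun x y hx hy => ?_⟩
  rw [key x hx, key y hy]
  rcases le_total y (η * x) with h | h
  · have h1 : x ^ (r - 1) * y ≤ x ^ (r - 1) * (η * x) := by gcongr
    have h2 : 0 ≤ (1 / η) ^ (r - 1) * (y ^ (r - 1) * y) := by positivity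
    linarith
  · have h1 : x ≤ 1 / η * y := by
      rw [div_mul_eq_mul_div, one_mul, le_div_iff₀ hη]; linarith
    have h2 : x ^ (r - 1) ≤ (1 / η * y) ^ (r - 1) := Real.rpow_le_rpow hx h1 (by linarith)
    rw [Real.mul_rpow (by positivity) hy] at h2
    have h3 := mul_le_mul_of_nonneg_right h2 hy
    have h4 : 0 ≤ η * (x ^ (r - 1) * x) := by positivity
    linarith

/-- For small `t` this is differentiability of `|·|^r` at `1`. For `|t| ≥ δ` one has `1 + |t| ≤ K
|t|`, so every term is at most a multiple of `|t| ^ r`. -/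
theorem exists_abs_one_add_rpow_sub_le {r ε : ℝ} (hr : 1 < r) (hε : 0 < ε) :
    ∃ C, 1 ≤ C ∧ ∀ t : ℝ, |(|1 + t| ^ r - 1 - r * t)| ≤ ε * |t| + C * |t| ^ r := by
  have hd := hasDerivAt_abs_rpow 1 hr
  rw [hasDerivAt_iff_isLittleO_nhds_zero] at hd
  obtain ⟨δ, hδ, hδ'⟩ := Metric.eventually_nhds_iff.1 (hd.bound hε)
  simp only [abs_one, Real.one_rpow, mul_one, smul_eq_mul, Real.norm_eq_abs, dist_zero_right] at hδ'
  set K : ℝ := 1 / δ + 1 with hK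
  have hK1 : 1 ≤ K := by rw [hK]; have : 0 ≤ 1 / δ := by positivity
                         linarith
  refine ⟨(2 + r) * K ^ r, ?_, fun t => ?_⟩
  · have := Real.one_le_rpow hK1 (by linarith : 0 ≤ r)
    nlinarith
  have hC : 0 ≤ (2 + r) * K ^ r * |t| ^ r := by positivity
  rcases lt_or_ge |t| δ with h | h
  · have := hδ' h
    rw [mul_comm t r] at this
    linarith
  · have h1 : 1 + |t| ≤ K * |t| := by
      have : 1 ≤ 1 / δ * |t| := by rw [div_mul_eq_mul_div, one_mul, le_div_iff₀ hδ]; linarith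
      rw [hK]; linarith
    have ht : 0 ≤ |t| := abs_nonneg t
    have h2 : (1 + |t|) ^ r ≤ K ^ r * |t| ^ r := by
      rw [← Real.mul_rpow (by linarith) ht]
      exact Real.rpow_le_rpow (by linarith) h1 (by linarith)
    have h3 : |1 + t| ^ r ≤ (1 + |t|) ^ r :=
      Real.rpow_le_rpow (abs_nonneg _) ((abs_add_le _ _).trans (by simp)) (by linarith)
    have h4 : 1 + |t| ≤ (1 + |t|) ^ r := Real.self_le_rpow_of_one_le (by linarith) hr.le
    have h5 : |(|1 + t| ^ r - 1 - r * t)| ≤ |1 + t| ^ r + 1 + r * |t| := by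
      have h6 : 0 ≤ |1 + t| ^ r := by positivity
      have h7 := neg_abs_le (r * t)
      have h8 := le_abs_self (r * t)
      rw [abs_mul, abs_of_pos (by linarith : 0 < r)] at h7 h8
      rw [abs_le]; constructor <;> linarith
    have h9 : 0 ≤ ε * |t| := by positivity
    nlinarith

/-- First-order expansion of `|·|^r` with a remainder controlled by homogeneity. -/
theorem exists_abs_add_rpow_sub_le {r ε : ℝ} (hr : 1 < r) (hε : 0 < ε) :
    ∃ C, 1 ≤ C ∧ ∀ x y : ℝ, |(|x + y| ^ r - |x| ^ r - r * (signedPow r x * y))| ≤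
      ε * (|x| ^ (r - 1) * |y|) + C * |y| ^ r := by
  obtain ⟨C, hC1, hC⟩ := exists_abs_one_add_rpow_sub_le hr hε
  refine ⟨C, hC1, fun x y => ?_⟩
  have hr0 : 0 < r := by linarith
  rcases eq_or_ne x 0 with rfl | hx
  -- Here the left side is `|y| ^ r`, which is why `1 ≤ C` is recorded.
  · have h1 : 0 ≤ |y| ^ r := by positivity
    simp only [zero_add, abs_zero, Real.zero_rpow hr0.ne', Real.zero_rpow (sub_pos.2 hr).ne',
      signedPow, mul_zero, zero_mul, sub_zero, abs_of_nonneg h1]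
    nlinarith
  · have h0 : 0 < |x| := abs_pos.2 hx
    -- Both sides are homogeneous of degree `r`, which reduces the estimate to base point `1`.
    obtain ⟨t, rfl⟩ : ∃ t, y = x * t := ⟨y / x, by field_simp⟩
    have h1 : |x + x * t| ^ r - |x| ^ r - r * (signedPow r x * (x * t)) =
        |x| ^ r * (|1 + t| ^ r - 1 - r * t) := by
      rw [← mul_assoc (signedPow r x), signedPow_mul_self hr0,
        show x + x * t = x * (1 + t) by ring, abs_mul, Real.mul_rpow h0.le (abs_nonneg _)]
      ring
    have h2 : |x| ^ (r - 1) * |x * t| = |x| ^ r * |t| := by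
      rw [abs_mul, ← mul_assoc]
      nth_rewrite 2 [← Real.rpow_one |x|]
      rw [← Real.rpow_add h0]; ring_nf
    rw [h1, h2, abs_mul, abs_of_nonneg (by positivity : 0 ≤ |x| ^ r), abs_mul,
      Real.mul_rpow h0.le (abs_nonneg t)]
    have := mul_le_mul_of_nonneg_left (hC t) (by positivity : 0 ≤ |x| ^ r)
    linarith

/-- The pointwise estimate behind the Brezis–Lieb lemma. The linear term and the mixed remainder
together contribute `1 + r` times `|x| ^ (r - 1) * |y|`, which Young's inequality absorbs. -/
theorem exists_abs_add_rpow_sub_sub_le {r ε : ℝ} (hr : 1 < r) (hε : 0 < ε) :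
    ∃ C, 0 ≤ C ∧ ∀ x y : ℝ, |(|x + y| ^ r - |x| ^ r - |y| ^ r)| ≤ ε * |x| ^ r + C * |y| ^ r := by
  obtain ⟨C, hC1, hC⟩ := exists_abs_add_rpow_sub_le hr one_pos
  obtain ⟨D, hD0, hD⟩ := exists_rpow_sub_one_mul_le hr (η := ε / (1 + r)) (by positivity)
  refine ⟨(1 + r) * D + C + 1, by positivity, fun x y => ?_⟩
  have h1 := hC x y
  have h2 := hD |x| |y| (abs_nonneg _) (abs_nonneg _)
  have h3 : |r * (signedPow r x * y)| = r * (|x| ^ (r - 1) * |y|) := by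
    rw [abs_mul, abs_mul, abs_signedPow hr, abs_of_pos (by linarith : 0 < r)]
  have h4 : (1 + r) * (|x| ^ (r - 1) * |y|) ≤ ε * |x| ^ r + (1 + r) * D * |y| ^ r := by
    have := mul_le_mul_of_nonneg_left h2 (by linarith : 0 ≤ 1 + r)
    calc _ ≤ _ := this
      _ = _ := by field_simp
  have h5 : 0 ≤ |y| ^ r := by positivity
  have h6 := abs_le.1 h1
  have h7 := abs_le.1 h3.le
  rw [abs_le]; constructor <;> linarith

/-! ### Limits of integrals -/

section Limits

variable {X : Type*} [MeasurableSpace X] {μ : Measure X}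

/-- Dominated convergence up to an arbitrarily small multiple of an `L^1`-bounded sequence. -/
theorem tendsto_integral_zero_of_le_mul_add {h k : ℕ → X → ℝ} {M : ℝ}
    (hm : ∀ j, AEStronglyMeasurable (h j) μ)
    (hlim : ∀ᵐ x ∂μ, Tendsto (fun j => h j x) atTop (𝓝 0))
    (hk : ∀ j, Integrable (k j) μ) (hk0 : ∀ j, ∀ᵐ x ∂μ, 0 ≤ k j x) (hkM : ∀ j, ∫ x, k j x ∂μ ≤ M)
    (hbd : ∀ ε > 0, ∃ G : X → ℝ, Integrable G μ ∧ ∀ j, ∀ᵐ x ∂μ, |h j x| ≤ ε * k j x + G x) :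
    Tendsto (fun j => ∫ x, h j x ∂μ) atTop (𝓝 0) := by
  rw [Metric.tendsto_atTop]
  intro ε hε
  have hM : 0 ≤ M := (integral_nonneg_of_ae (hk0 0)).trans (hkM 0)
  -- The part of `|h j|` below `η * k j` then integrates to at most `ε / 2`; the excess over it is
  -- dominated by the fixed function `|G|`, so dominated convergence applies to it.
  set η := ε / (2 * (M + 1)) with hη
  have hη0 : 0 < η := by positivity
  obtain ⟨G, hG, hGb⟩ := hbd η hη0
  have hWm : ∀ j, AEStronglyMeasurable (fun x => max (|h j x| - η * k j x) 0) μ := fun j =>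
    (((hm j).norm.sub ((hk j).1.const_mul η)).sup aestronglyMeasurable_const)
  have hWle : ∀ j, ∀ᵐ x ∂μ, ‖max (|h j x| - η * k j x) 0‖ ≤ |G x| := by
    intro j
    filter_upwards [hGb j] with x hx
    rw [Real.norm_eq_abs, abs_of_nonneg (le_max_right _ _)]
    exact max_le ((by linarith : _ ≤ G x).trans (le_abs_self _)) (abs_nonneg _)
  have hW : Tendsto (fun j => ∫ x, max (|h j x| - η * k j x) 0 ∂μ) atTop (𝓝 0) := by
    suffices h : ∀ᵐ x ∂μ, Tendsto (fun j => max (|h j x| - η * k j x) 0) atTop (𝓝 0) by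
      have := tendsto_integral_of_dominated_convergence (fun x => |G x|) hWm hG.abs hWle h
      rwa [integral_zero] at this
    filter_upwards [hlim, ae_all_iff.2 hk0] with x hx hx0
    refine squeeze_zero (fun j => le_max_right _ _) (fun j => ?_) (by simpa using hx.abs)
    exact max_le (by have := mul_nonneg hη0.le (hx0 j); linarith) (abs_nonneg _)
  obtain ⟨n, hn⟩ := Metric.tendsto_atTop.1 hW (ε / 2) (by positivity)
  refine ⟨n, fun j hj => ?_⟩
  have h1 := hn j hj
  rw [Real.dist_0_eq_abs] at h1 ⊢
  have hWi : Integrable (fun x => max (|h j x| - η * k j x) 0) μ := hG.abs.mono' (hWm j) (hWle j)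
  have h2 : |∫ x, h j x ∂μ| ≤ ∫ x, (max (|h j x| - η * k j x) 0 + η * k j x) ∂μ := by
    have hi : Integrable (fun x => max (|h j x| - η * k j x) 0 + η * k j x) μ :=
      hWi.add ((hk j).const_mul η)
    rw [← Real.norm_eq_abs]
    refine norm_integral_le_of_norm_le hi ?_
    filter_upwards with x
    have := le_max_left (|h j x| - η * k j x) 0
    rw [Real.norm_eq_abs]; linarith
  rw [integral_add hWi ((hk j).const_mul η), integral_const_mul] at h2
  have h3 : η * ∫ x, k j x ∂μ ≤ η * (M + 1) := by
    gcongr; linarith [hkM j]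
  have h4 : η * (M + 1) = ε / 2 := by rw [hη]; field_simp
  have h5 := le_abs_self (∫ x, max (|h j x| - η * k j x) 0 ∂μ)
  linarith

theorem MemLp.integrable_abs_rpow {r : ℝ} (hr : 0 < r) {f : X → ℝ}
    (hf : MemLp f (ENNReal.ofReal r) μ) : Integrable (fun x => |f x| ^ r) μ := by
  have := hf.integrable_norm_rpow (by simpa using hr) ENNReal.ofReal_ne_top
  simpa [ENNReal.toReal_ofReal hr.le] using this

theorem MemLp.integrable_rpow_mul_abs {r : ℝ} (hr : 1 < r) {f g : X → ℝ}
    (hf : MemLp f (ENNReal.ofReal r) μ) (hg : MemLp g (ENNReal.ofReal r) μ) :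
    Integrable (fun x => |f x| ^ (r - 1) * |g x|) μ := by
  obtain ⟨C, hC0, hC⟩ := exists_rpow_sub_one_mul_le hr one_pos
  have hr0 : 0 < r := by linarith
  refine ((MemLp.integrable_abs_rpow hr0 hf).add
    ((MemLp.integrable_abs_rpow hr0 hg).const_mul C)).mono' ?_ ?_
  · exact ((hf.1.norm.aemeasurable.pow_const _).mul hg.1.norm.aemeasurable).aestronglyMeasurable
  · filter_upwards with x
    rw [Real.norm_eq_abs, abs_of_nonneg (by positivity)]
    simpa using hC |f x| |g x| (abs_nonneg _) (abs_nonneg _)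

theorem MemLp.integrable_signedPow_mul {r : ℝ} (hr : 1 < r) {f g : X → ℝ}
    (hf : MemLp f (ENNReal.ofReal r) μ) (hg : MemLp g (ENNReal.ofReal r) μ) :
    Integrable (fun x => signedPow r (f x) * g x) μ := by
  refine (MemLp.integrable_rpow_mul_abs hr hf hg).mono'
    (((continuous_signedPow hr).comp_aestronglyMeasurable hf.1).mul hg.1) ?_
  filter_upwards with x
  rw [Real.norm_eq_abs, abs_mul, abs_signedPow hr]

/-- This plays the role of weak convergence of `|f_j|^(r-2) f_j`. No common dominating function is
available, but Young's inequality bounds the integrand by `ε |f_j|^r` plus a fixed integrable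
function. -/
theorem tendsto_integral_signedPow_mul {r M : ℝ} (hr : 1 < r) {f : ℕ → X → ℝ} {f₀ g : X → ℝ}
    (hf : ∀ j, MemLp (f j) (ENNReal.ofReal r) μ) (hf₀ : MemLp f₀ (ENNReal.ofReal r) μ)
    (hg : MemLp g (ENNReal.ofReal r) μ)
    (hlim : ∀ᵐ x ∂μ, Tendsto (fun j => f j x) atTop (𝓝 (f₀ x)))
    (hM : ∀ j, ∫ x, |f j x| ^ r ∂μ ≤ M) :
    Tendsto (fun j => ∫ x, signedPow r (f j x) * g x ∂μ) atTop
      (𝓝 (∫ x, signedPow r (f₀ x) * g x ∂μ)) := by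
  have hr0 : 0 < r := by linarith
  have hc := continuous_signedPow hr
  rw [← tendsto_sub_nhds_zero_iff]
  simp_rw [← fun j => integral_sub (MemLp.integrable_signedPow_mul hr (hf j) hg)
    (MemLp.integrable_signedPow_mul hr hf₀ hg)]
  refine tendsto_integral_zero_of_le_mul_add (k := fun j x => |f j x| ^ r) (M := M)
    (fun j => ?_) ?_ (fun j => MemLp.integrable_abs_rpow hr0 (hf j))
    (fun j => ae_of_all _ fun x => by positivity) hM fun ε hε => ?_
  · exact ((MemLp.integrable_signedPow_mul hr (hf j) hg).sub
      (MemLp.integrable_signedPow_mul hr hf₀ hg)).1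
  · filter_upwards [hlim] with x hx
    have := (((hc.tendsto _).comp hx).mul_const (g x)).sub_const (signedPow r (f₀ x) * g x)
    simpa using this
  · obtain ⟨C, hC0, hC⟩ := exists_rpow_sub_one_mul_le hr hε
    refine ⟨fun x => C * |g x| ^ r + |f₀ x| ^ (r - 1) * |g x|,
      ((MemLp.integrable_abs_rpow hr0 hg).const_mul C).add
        (MemLp.integrable_rpow_mul_abs hr hf₀ hg), fun j => ae_of_all _ fun x => ?_⟩
    have h1 := hC |f j x| |g x| (abs_nonneg _) (abs_nonneg _)
    have h2 := abs_sub (signedPow r (f j x) * g x) (signedPow r (f₀ x) * g x)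
    rw [abs_mul, abs_mul, abs_signedPow hr, abs_signedPow hr] at h2
    linarith

/-- The Brezis-Lieb lemma. -/
theorem tendsto_integral_abs_rpow_sub {r M : ℝ} (hr : 1 < r) {f : ℕ → X → ℝ} {f₀ : X → ℝ}
    (hf : ∀ j, MemLp (f j) (ENNReal.ofReal r) μ) (hf₀ : MemLp f₀ (ENNReal.ofReal r) μ)
    (hlim : ∀ᵐ x ∂μ, Tendsto (fun j => f j x) atTop (𝓝 (f₀ x)))
    (hM : ∀ j, ∫ x, |f j x - f₀ x| ^ r ∂μ ≤ M) :
    Tendsto (fun j => ∫ x, |f j x| ^ r ∂μ - ∫ x, |f j x - f₀ x| ^ r ∂μ) atTop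
      (𝓝 (∫ x, |f₀ x| ^ r ∂μ)) := by
  have hr0 : 0 < r := by linarith
  have hi := fun j => MemLp.integrable_abs_rpow hr0 (hf j)
  have hi' : ∀ j, Integrable (fun x => |f j x - f₀ x| ^ r) μ :=
    fun j => MemLp.integrable_abs_rpow hr0 ((hf j).sub hf₀)
  have hi₀ := MemLp.integrable_abs_rpow hr0 hf₀
  rw [← tendsto_sub_nhds_zero_iff]
  have heq : ∀ j, ∫ x, |f j x| ^ r ∂μ - ∫ x, |f j x - f₀ x| ^ r ∂μ - ∫ x, |f₀ x| ^ r ∂μ =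
      ∫ x, (|f j x| ^ r - |f j x - f₀ x| ^ r - |f₀ x| ^ r) ∂μ := fun j => by
    rw [← integral_sub (hi j) (hi' j)]
    exact (integral_sub ((hi j).sub (hi' j)) hi₀).symm
  simp_rw [heq]
  refine tendsto_integral_zero_of_le_mul_add (k := fun j x => |f j x - f₀ x| ^ r) (M := M)
    (fun j => (((hi j).sub (hi' j)).sub hi₀).1) ?_ hi'
    (fun j => ae_of_all _ fun x => by positivity) hM fun ε hε => ?_
  · filter_upwards [hlim] with x hx
    have hc : Continuous fun t : ℝ => |t| ^ r - |t - f₀ x| ^ r - |f₀ x| ^ r :=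
      ((continuous_abs.rpow_const fun _ => Or.inr hr0.le).sub
        ((continuous_id.sub continuous_const).abs.rpow_const fun _ => Or.inr hr0.le)).sub
        continuous_const
    simpa [Function.comp_def, Real.zero_rpow hr0.ne'] using (hc.tendsto _).comp hx
  -- The small factor goes with the bounded increment `f j - f₀`, the large constant with the fixed
  -- `f₀`.
  · obtain ⟨C, hC0, hC⟩ := exists_abs_add_rpow_sub_sub_le hr hε
    refine ⟨fun x => C * |f₀ x| ^ r, hi₀.const_mul C, fun j => ae_of_all _ fun x => ?_⟩
    simpa using hC (f j x - f₀ x) (f₀ x)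

end Limits

/-! ### The functional `f ↦ ∫ |f|^r` on `L^r` -/

section LpPower

variable {X : Type*} [MeasurableSpace X] {μ : Measure X} {r : ℝ}

theorem norm_rpow_eq_integral (hr : 0 < r) (f : Lp ℝ (ENNReal.ofReal r) μ) :
    ‖f‖ ^ r = ∫ x, |f x| ^ r ∂μ := by
  have h := (Lp.memLp f).eLpNorm_eq_integral_rpow_norm (by simpa using hr) ENNReal.ofReal_ne_top
  rw [ENNReal.toReal_ofReal hr.le] at h
  have h0 : 0 ≤ ∫ x, |f x| ^ r ∂μ := integral_nonneg fun x => by positivity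
  rw [Lp.norm_def, h, ENNReal.toReal_ofReal (by positivity), ← Real.rpow_mul (by positivity),
    inv_mul_cancel₀ hr.ne', Real.rpow_one]
  rfl

variable [Fact (1 ≤ ENNReal.ofReal r)]

theorem integral_rpow_mul_abs_le (hr : 1 < r) (f g : Lp ℝ (ENNReal.ofReal r) μ) :
    ∫ x, |f x| ^ (r - 1) * |g x| ∂μ ≤ ‖f‖ ^ (r - 1) * ‖g‖ := by
  have hr0 : 0 < r := by linarith
  have hconj : (r / (r - 1)).HolderConjugate r := by
    exact (Real.HolderConjugate.conjExponent hr).symm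
  have hr1 : 0 < r - 1 := by linarith
  have hpow : ∀ x, (|f x| ^ (r - 1)) ^ (r / (r - 1)) = |f x| ^ r := fun x => by
    rw [← Real.rpow_mul (abs_nonneg _), mul_div_cancel₀ _ hr1.ne']
  have hf' : MemLp (fun x => |f x| ^ (r - 1)) (ENNReal.ofReal (r / (r - 1))) μ := by
    rw [← integrable_norm_rpow_iff _ (by simpa using div_pos hr0 hr1) ENNReal.ofReal_ne_top,
      ENNReal.toReal_ofReal (by positivity)]
    · refine (MemLp.integrable_abs_rpow hr0 (Lp.memLp f)).congr (ae_of_all _ fun x => ?_)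
      simp only [Real.norm_eq_abs]
      rw [abs_of_nonneg (a := |f x| ^ (r - 1)) (by positivity), hpow]
    · exact ((Lp.aestronglyMeasurable f).norm.aemeasurable.pow_const _).aestronglyMeasurable
  have h := integral_mul_le_Lp_mul_Lq_of_nonneg hconj (ae_of_all μ fun x => by positivity)
    (ae_of_all μ fun x => abs_nonneg (g x)) hf' (Lp.memLp g).norm
  simp_rw [hpow] at h
  rw [← norm_rpow_eq_integral hr0, ← norm_rpow_eq_integral hr0, ← Real.rpow_mul (norm_nonneg _),
    ← Real.rpow_mul (norm_nonneg _), mul_one_div_cancel hr0.ne', Real.rpow_one,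
    show r * (1 / (r / (r - 1))) = r - 1 by field_simp] at h
  exact h

/-- The functional `g ↦ ∫ |f|^(r-2) f g` on `L^r`. -/
def powDeriv (hr : 1 < r) (f : Lp ℝ (ENNReal.ofReal r) μ) :
    Lp ℝ (ENNReal.ofReal r) μ →L[ℝ] ℝ :=
  LinearMap.mkContinuous
    { toFun := fun g => ∫ x, signedPow r (f x) * g x ∂μ
      map_add' := fun g h => by
        rw [← integral_add (MemLp.integrable_signedPow_mul hr (Lp.memLp f) (Lp.memLp g))
          (MemLp.integrable_signedPow_mul hr (Lp.memLp f) (Lp.memLp h))]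
        refine integral_congr_ae ?_
        filter_upwards [Lp.coeFn_add g h] with x hx
        rw [hx, Pi.add_apply, mul_add]
      map_smul' := fun k g => by
        rw [RingHom.id_apply, smul_eq_mul, ← integral_const_mul]
        refine integral_congr_ae ?_
        filter_upwards [Lp.coeFn_smul k g] with x hx
        rw [hx, Pi.smul_apply, smul_eq_mul]; ring }
    (‖f‖ ^ (r - 1)) fun g => by
      refine le_trans ?_ (integral_rpow_mul_abs_le hr f g)
      refine norm_integral_le_of_norm_le
        (MemLp.integrable_rpow_mul_abs hr (Lp.memLp f) (Lp.memLp g)) (ae_of_all _ fun x => ?_)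
      rw [Real.norm_eq_abs, abs_mul, abs_signedPow hr]

theorem powDeriv_apply (hr : 1 < r) (f g : Lp ℝ (ENNReal.ofReal r) μ) :
    powDeriv hr f g = ∫ x, signedPow r (f x) * g x ∂μ := rfl

theorem powDeriv_self (hr : 1 < r) (f : Lp ℝ (ENNReal.ofReal r) μ) :
    powDeriv hr f f = ‖f‖ ^ r := by
  have hr0 : 0 < r := by linarith
  rw [powDeriv_apply, norm_rpow_eq_integral hr0]
  simp_rw [signedPow_mul_self hr0]

/-- The pointwise expansion is integrated. By Hölder the remainder is at most a small multiple of
`‖f‖ ^ (r - 1) * ‖g‖` plus `C * ‖g‖ ^ r`, and the latter is `o(‖g‖)` because `r > 1`. -/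
theorem hasFDerivAt_norm_rpow_Lp (hr : 1 < r) (f : Lp ℝ (ENNReal.ofReal r) μ) :
    HasFDerivAt (fun g : Lp ℝ (ENNReal.ofReal r) μ => ‖g‖ ^ r) (r • powDeriv hr f) f := by
  have hr0 : 0 < r := by linarith
  rw [hasFDerivAt_iff_isLittleO_nhds_zero, Asymptotics.isLittleO_iff]
  intro ε hε
  set A := ‖f‖ ^ (r - 1) with hA
  have hA0 : 0 ≤ A := by positivity
  obtain ⟨C, hC1, hC⟩ := exists_abs_add_rpow_sub_le hr (ε := ε / (2 * (A + 1))) (by positivity)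
  have hsmall : ∀ᶠ g : Lp ℝ (ENNReal.ofReal r) μ in 𝓝 0, C * ‖g‖ ^ (r - 1) < ε / 2 := by
    have hc : Continuous fun g : Lp ℝ (ENNReal.ofReal r) μ => C * ‖g‖ ^ (r - 1) :=
      continuous_const.mul (continuous_norm.rpow_const fun _ => Or.inr (by linarith))
    refine hc.continuousAt.eventually_lt continuousAt_const ?_
    simp only [norm_zero, Real.zero_rpow (sub_pos.2 hr).ne', mul_zero]
    positivity
  filter_upwards [hsmall] with g hg
  have hif := MemLp.integrable_abs_rpow hr0 (Lp.memLp f)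
  have hig := MemLp.integrable_abs_rpow hr0 (Lp.memLp g)
  have hifg := MemLp.integrable_rpow_mul_abs hr (Lp.memLp f) (Lp.memLp g)
  have his := MemLp.integrable_signedPow_mul hr (Lp.memLp f) (Lp.memLp g)
  have hia : Integrable (fun x => |f x + g x| ^ r) μ :=
    MemLp.integrable_abs_rpow hr0 ((Lp.memLp f).add (Lp.memLp g))
  have h1 : ‖f + g‖ ^ r - ‖f‖ ^ r - (r • powDeriv hr f) g =
      ∫ x, (|f x + g x| ^ r - |f x| ^ r - r * (signedPow r (f x) * g x)) ∂μ := by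
    have h0 : ‖f + g‖ ^ r = ∫ x, |f x + g x| ^ r ∂μ := by
      rw [norm_rpow_eq_integral hr0]
      refine integral_congr_ae ?_
      filter_upwards [Lp.coeFn_add f g] with x hx
      rw [hx, Pi.add_apply]
    rw [h0, norm_rpow_eq_integral hr0, ← integral_sub hia hif, smul_apply,
      powDeriv_apply, smul_eq_mul, ← integral_const_mul]
    exact (integral_sub (hia.sub hif) (his.const_mul r)).symm
  have h2 : ‖‖f + g‖ ^ r - ‖f‖ ^ r - (r • powDeriv hr f) g‖ ≤
      ε / (2 * (A + 1)) * (∫ x, |f x| ^ (r - 1) * |g x| ∂μ) + C * ‖g‖ ^ r := by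
    rw [h1, norm_rpow_eq_integral hr0, ← integral_const_mul, ← integral_const_mul,
      ← integral_add (hifg.const_mul _) (hig.const_mul _)]
    exact norm_integral_le_of_norm_le ((hifg.const_mul _).add (hig.const_mul _))
      (ae_of_all _ fun x => hC (f x) (g x))
  have h3 := integral_rpow_mul_abs_le hr f g
  have h4 : ‖g‖ ^ r = ‖g‖ ^ (r - 1) * ‖g‖ := by
    conv_rhs => rw [← Real.rpow_one ‖g‖]
    rw [← Real.rpow_mul (norm_nonneg _), one_mul, ← Real.rpow_add' (norm_nonneg _) (by linarith)]
    ring_nf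
  have h5 : ε / (2 * (A + 1)) * (∫ x, |f x| ^ (r - 1) * |g x| ∂μ) ≤ ε / 2 * ‖g‖ := by
    calc _ ≤ ε / (2 * (A + 1)) * (A * ‖g‖) := by gcongr
      _ ≤ ε / (2 * (A + 1)) * ((A + 1) * ‖g‖) := by gcongr; linarith
      _ = ε / 2 * ‖g‖ := by field_simp
  have h6 : C * ‖g‖ ^ r ≤ ε / 2 * ‖g‖ := by
    rw [h4, ← mul_assoc]
    gcongr
  linarith

end LpPower

/-! ### Means over the cells of a cubic grid -/

section Cells

variable {N : ℕ}

/-- The index of the cell of the cubic grid of side `r` that contains `x`. -/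
def cell (r : ℝ) (x : Space N) : Fin N → ℤ := fun i => ⌊x i / r⌋

/-- The cell with index `k` of the cubic grid of side `r`. -/
def cellSet (r : ℝ) (k : Fin N → ℤ) : Set (Space N) := cell r ⁻¹' {k}

/-- The mean of a function over a cell of the cubic grid of side `r`. -/
def cellMean (r : ℝ) (k : Fin N → ℤ) (u : Space N → ℝ) : ℝ :=
  ∫ y, u y ∂(ProbabilityTheory.cond volume (cellSet r k))

theorem measurable_cell (r : ℝ) : Measurable (cell r : Space N → Fin N → ℤ) := by
  refine measurable_pi_iff.2 fun i => Int.measurable_floor.comp ?_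
  fun_prop

theorem measurableSet_cellSet (r : ℝ) (k : Fin N → ℤ) : MeasurableSet (cellSet r k) :=
  measurable_cell r (measurableSet_singleton k)

theorem volume_cellSet {r : ℝ} (hr : 0 < r) (k : Fin N → ℤ) :
    volume (cellSet r k) = ENNReal.ofReal (r ^ N) := by
  have h1 : cellSet r k = (WithLp.ofLp : Space N → Fin N → ℝ) ⁻¹'
      (Set.pi Set.univ fun i => Set.Ico (k i * r) ((k i + 1) * r)) := by
    ext x
    simp only [cellSet, cell, Set.mem_preimage, Set.mem_singleton_iff, funext_iff, Int.floor_eq_iff,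
      Set.mem_pi, Set.mem_univ, true_imp_iff, Set.mem_Ico, le_div_iff₀ hr, div_lt_iff₀ hr]
  rw [h1, (PiLp.volume_preserving_ofLp (Fin N)).measure_preimage
    (MeasurableSet.univ_pi fun _ => measurableSet_Ico).nullMeasurableSet, Real.volume_pi_Ico]
  simp [add_mul, ENNReal.ofReal_pow hr.le]

theorem norm_sub_le_of_cell_eq {r : ℝ} (hr : 0 < r) {x y : Space N} (h : cell r y = cell r x) :
    ‖x - y‖ ≤ √N * r := by
  have h1 : ∀ i, ‖(x - y) i‖ ^ 2 ≤ r ^ 2 := fun i => by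
    have h2 := Int.abs_sub_lt_one_of_floor_eq_floor (congrFun h i).symm
    rw [← sub_div, abs_div, abs_of_pos hr, div_lt_one hr] at h2
    rw [PiLp.sub_apply, Real.norm_eq_abs]
    gcongr
  rw [EuclideanSpace.norm_eq, ← Real.sqrt_sq hr.le, ← Real.sqrt_mul (Nat.cast_nonneg N)]
  refine Real.sqrt_le_sqrt ?_
  simpa using Finset.sum_le_sum fun i (_ : i ∈ Finset.univ) => h1 i

theorem isProbabilityMeasure_cond_cellSet {r : ℝ} (hr : 0 < r) (k : Fin N → ℤ) :
    IsProbabilityMeasure (ProbabilityTheory.cond volume (cellSet r k)) := by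
  refine ProbabilityTheory.cond_isProbabilityMeasure_of_finite ?_ ?_
  · rw [volume_cellSet hr]; simp; positivity
  · rw [volume_cellSet hr]; exact ENNReal.ofReal_ne_top

/-- Jensen's inequality, read off from the monotonicity of `L^m` norms in the exponent on a
probability space. -/
theorem enorm_integral_rpow_le {X : Type*} [MeasurableSpace X] {ν : Measure X}
    [IsProbabilityMeasure ν] {m : ℝ} (hm : 1 ≤ m) {f : X → ℝ} (hf : AEStronglyMeasurable f ν) :
    ‖∫ x, f x ∂ν‖ₑ ^ m ≤ ∫⁻ x, ‖f x‖ₑ ^ m ∂ν := by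
  have hm0 : 0 < m := by linarith
  have h1 : ‖∫ x, f x ∂ν‖ₑ ≤ eLpNorm f (ENNReal.ofReal m) ν := by
    refine (enorm_integral_le_lintegral_enorm f).trans ?_
    rw [← eLpNorm_one_eq_lintegral_enorm]
    exact eLpNorm_le_eLpNorm_of_exponent_le (by simpa using ENNReal.ofReal_le_ofReal hm) hf
  rw [eLpNorm_eq_lintegral_rpow_enorm_toReal (by simpa using hm0) ENNReal.ofReal_ne_top,
    ENNReal.toReal_ofReal hm0.le] at h1
  have h2 := ENNReal.rpow_le_rpow h1 hm0.le
  rwa [← ENNReal.rpow_mul, one_div_mul_cancel hm0.ne', ENNReal.rpow_one] at h2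

theorem lintegral_cond_cellSet {r : ℝ} (hr : 0 < r) (k : Fin N → ℤ) (f : Space N → ℝ≥0∞) :
    ∫⁻ x, f x ∂(ProbabilityTheory.cond volume (cellSet r k)) =
      ENNReal.ofReal (r ^ (-(N : ℝ))) * ∫⁻ x in cellSet r k, f x := by
  rw [ProbabilityTheory.cond, lintegral_smul_measure, volume_cellSet hr, smul_eq_mul,
    ← ENNReal.ofReal_inv_of_pos (by positivity), Real.rpow_neg hr.le, Real.rpow_natCast]

theorem enorm_cellMean_rpow_le {r m : ℝ} (hr : 0 < r) (hm : 1 ≤ m) (k : Fin N → ℤ)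
    {u : Space N → ℝ} (hu : AEStronglyMeasurable u volume) :
    ‖cellMean r k u‖ₑ ^ m ≤ ENNReal.ofReal (r ^ (-(N : ℝ))) * ∫⁻ x, ‖u x‖ₑ ^ m := by
  have := isProbabilityMeasure_cond_cellSet hr k
  refine (enorm_integral_rpow_le hm
    (hu.mono_ac ProbabilityTheory.cond_absolutelyContinuous)).trans ?_
  rw [lintegral_cond_cellSet hr]
  gcongr
  exact Measure.restrict_le_self

theorem integrable_cond_cellSet {r m : ℝ} (hr : 0 < r) (hm : 1 ≤ m) (k : Fin N → ℤ)
    {u : Space N → ℝ} (hu : MemLp u (ENNReal.ofReal m) volume) :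
    Integrable u (ProbabilityTheory.cond volume (cellSet r k)) := by
  have := isProbabilityMeasure_cond_cellSet hr k
  have h1 : MemLp u (ENNReal.ofReal m) (ProbabilityTheory.cond volume (cellSet r k)) := by
    refine (hu.restrict (cellSet r k)).smul_measure ?_
    rw [volume_cellSet hr]; simp; positivity
  exact h1.integrable (by simpa using ENNReal.ofReal_le_ofReal hm)

/-- The inner integral of the Gagliardo seminorm. -/
def gagliardoDensity (s p : ℝ) (u : Space N → ℝ) (x : Space N) : ℝ≥0∞ :=
  ∫⁻ y, ENNReal.ofReal (gagliardoIntegrand s p u (x, y))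

theorem lintegral_gagliardoDensity {s p : ℝ} (hp : 0 < p) {u : Space N → ℝ}
    (hu : AEStronglyMeasurable u volume) :
    ∫⁻ x, gagliardoDensity s p u x = gagliardoLIntegral s p u := by
  have h : AEMeasurable (fun z : Space N × Space N =>
      ENNReal.ofReal (gagliardoIntegrand s p u z)) volume := by
    simp_rw [← enorm_diffQuot_rpow s hp]
    exact (aestronglyMeasurable_diffQuot s p hu).enorm.pow_const _
  rw [Measure.volume_eq_prod] at h
  rw [gagliardoLIntegral, Measure.volume_eq_prod]
  exact (lintegral_prod _ h).symm

theorem aemeasurable_gagliardoDensity {s p : ℝ} (hp : 0 < p) {u : Space N → ℝ}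
    (hu : AEStronglyMeasurable u volume) : AEMeasurable (gagliardoDensity s p u) volume := by
  have h : AEMeasurable (fun z : Space N × Space N =>
      ENNReal.ofReal (gagliardoIntegrand s p u z)) (volume.prod volume) := by
    rw [← Measure.volume_eq_prod]
    simp_rw [← enorm_diffQuot_rpow s hp]
    exact (aestronglyMeasurable_diffQuot s p hu).enorm.pow_const _
  exact h.lintegral_prod_right'

/-- A pointwise Poincaré inequality: Jensen is applied to `y ↦ u x - u y` on the cell. There `|x -
y| ≤ √N r`, so the kernel can be inserted at the cost of `(√N r)^(N + sp)`; the cell volume `r^N`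
leaves `r^(sp)`. -/
theorem enorm_sub_cellMean_rpow_le {r s p : ℝ} (hr : 0 < r) (hs : 0 < s) (hp : 1 < p)
    {u : Space N → ℝ} (x : Space N)
    (hi : Integrable u (ProbabilityTheory.cond volume (cellSet r (cell r x)))) :
    ‖u x - cellMean r (cell r x) u‖ₑ ^ p ≤
      ENNReal.ofReal (√N ^ (N + s * p) * r ^ (s * p)) * gagliardoDensity s p u x := by
  have hp0 : 0 < p := by linarith
  have hsp : 0 < N + s * p := by positivity
  have := isProbabilityMeasure_cond_cellSet hr (cell r x)
  have h1 : u x - cellMean r (cell r x) u =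
      ∫ y, (u x - u y) ∂(ProbabilityTheory.cond volume (cellSet r (cell r x))) := by
    rw [integral_sub (integrable_const _) hi, cellMean]; simp
  have h2 : ∀ y ∈ cellSet r (cell r x), ‖u x - u y‖ₑ ^ p ≤
      ENNReal.ofReal ((√N * r) ^ (N + s * p)) *
        ENNReal.ofReal (gagliardoIntegrand s p u (x, y)) := by
    intro y hy
    have hd := norm_sub_le_of_cell_eq hr hy
    rw [← ENNReal.ofReal_mul (by positivity), ← ofReal_norm, Real.norm_eq_abs,
      ENNReal.ofReal_rpow_of_nonneg (abs_nonneg _) hp0.le]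
    refine ENNReal.ofReal_le_ofReal ?_
    rcases eq_or_ne x y with rfl | hxy
    · simp only [sub_self, abs_zero, Real.zero_rpow hp0.ne', gagliardoIntegrand, zero_div,
        mul_zero, le_refl]
    · have h0 : 0 < ‖x - y‖ := norm_pos_iff.2 (sub_ne_zero.2 hxy)
      have h3 : ‖x - y‖ ^ (N + s * p) ≤ (√N * r) ^ (N + s * p) :=
        Real.rpow_le_rpow h0.le hd hsp.le
      rw [gagliardoIntegrand, mul_div_assoc', le_div_iff₀ (by positivity), mul_comm]
      gcongr
  rw [h1]
  refine (enorm_integral_rpow_le hp.le (aestronglyMeasurable_const.sub hi.1)).trans ?_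
  rw [lintegral_cond_cellSet hr]
  calc _ ≤ ENNReal.ofReal (r ^ (-(N : ℝ))) * ∫⁻ y in cellSet r (cell r x),
        ENNReal.ofReal ((√N * r) ^ (N + s * p)) *
          ENNReal.ofReal (gagliardoIntegrand s p u (x, y)) := by
        refine mul_le_mul_right ?_ _
        exact setLIntegral_mono' (measurableSet_cellSet _ _) h2
    _ ≤ ENNReal.ofReal (r ^ (-(N : ℝ))) * (ENNReal.ofReal ((√N * r) ^ (N + s * p)) *
          gagliardoDensity s p u x) := by
        gcongr
        refine (setLIntegral_le_lintegral _ _).trans ?_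
        rw [lintegral_const_mul' _ _ ENNReal.ofReal_ne_top, gagliardoDensity]
    _ = _ := by
        rw [← mul_assoc, ← ENNReal.ofReal_mul (by positivity),
          Real.mul_rpow (by positivity) hr.le, mul_left_comm, ← Real.rpow_add hr]
        ring_nf

end Cells

/-! ### The fractional Sobolev inequality -/

theorem mul_lt_dim (N : ℕ) (s p : ℝ) [hs : Fact (s ∈ Set.Ioo (0 : ℝ) 1)]
    [hp : Fact (p ∈ Set.Ioo 1 ((N : ℝ) / s))] : s * p < N := by
  have h2 := (lt_div_iff₀ hs.out.1).1 hp.out.2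
  linarith

theorem dim_pos (N : ℕ) (s p : ℝ) [hs : Fact (s ∈ Set.Ioo (0 : ℝ) 1)]
    [hp : Fact (p ∈ Set.Ioo 1 ((N : ℝ) / s))] : (0 : ℝ) < N :=
  (mul_pos hs.out.1 (exp_pos N s p)).trans (mul_lt_dim N s p)

theorem lt_critExp (N : ℕ) (s p : ℝ) [hs : Fact (s ∈ Set.Ioo (0 : ℝ) 1)]
    [hp : Fact (p ∈ Set.Ioo 1 ((N : ℝ) / s))] : p < critExp N s p := by
  have h1 := mul_lt_dim N s p
  have h2 := exp_pos N s p
  have h3 := mul_pos hs.out.1 h2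
  rw [critExp, lt_div_iff₀ (sub_pos.2 h1)]
  nlinarith

theorem one_lt_critExp (N : ℕ) (s p : ℝ) [hs : Fact (s ∈ Set.Ioo (0 : ℝ) 1)]
    [hp : Fact (p ∈ Set.Ioo 1 ((N : ℝ) / s))] : 1 < critExp N s p := hp.out.1.trans (lt_critExp N s p)

theorem critExp_mul (N : ℕ) (s p : ℝ) [hs : Fact (s ∈ Set.Ioo (0 : ℝ) 1)]
    [hp : Fact (p ∈ Set.Ioo 1 ((N : ℝ) / s))] : critExp N s p * (1 - s * p / N) = p := by
  have h1 := mul_lt_dim N s p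
  have h2 := dim_pos N s p
  have h3 : (N : ℝ) - s * p ≠ 0 := (sub_pos.2 h1).ne'
  have h4 : (N : ℝ) - p * s ≠ 0 := by rwa [mul_comm p]
  rw [critExp]; field_simp

theorem dim_div_critExp (N : ℕ) (s p : ℝ) [hs : Fact (s ∈ Set.Ioo (0 : ℝ) 1)]
    [hp : Fact (p ∈ Set.Ioo 1 ((N : ℝ) / s))] : N / critExp N s p = N / p * (1 - s * p / N) := by
  have h1 := mul_lt_dim N s p
  have h2 := dim_pos N s p
  have h3 : (N : ℝ) - s * p ≠ 0 := (sub_pos.2 h1).ne'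
  have h4 := exp_pos N s p
  rw [critExp]; field_simp


instance {N : ℕ} {s p : ℝ} [hs : Fact (s ∈ Set.Ioo (0 : ℝ) 1)]
    [hp : Fact (p ∈ Set.Ioo 1 ((N : ℝ) / s))] : Fact (1 ≤ ENNReal.ofReal (critExp N s p)) :=
  ⟨by simpa using ENNReal.ofReal_le_ofReal (one_lt_critExp N s p).le⟩

/-- Optimisation of the cell size: the powers of `r` in the two terms balance when `r ^ n = A / G`.
-/
theorem le_rpow_mul_rpow_of_forall {v K G A s n θ : ℝ} (hG : 0 ≤ G)
    (hA : 0 < A) (hn : 0 < n) (hsθ : s = n * θ) (hθ : θ < 1)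
    (h : ∀ r : ℝ, 0 < r → v ≤ K * r ^ s * G + r ^ (-(n * (1 - θ))) * A) :
    v ≤ (K + 1) * A ^ θ * G ^ (1 - θ) := by
  rcases hG.eq_or_lt with rfl | hG
  -- For `G = 0` there is no optimal `r`; the bound follows as `r → ∞`.
  · rw [Real.zero_rpow (by linarith), mul_zero]
    have h1 : Tendsto (fun r : ℝ => r ^ (-(n * (1 - θ))) * A) atTop (𝓝 (0 * A)) :=
      (tendsto_rpow_neg_atTop (mul_pos hn (sub_pos.2 hθ))).mul_const A
    rw [zero_mul] at h1
    refine ge_of_tendsto h1 ?_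
    filter_upwards [eventually_gt_atTop 0] with r hr
    simpa using h r hr
  · have hq : 0 < A / G := by positivity
    have h1 := h ((A / G) ^ (1 / n)) (by positivity)
    rw [← Real.rpow_mul hq.le, ← Real.rpow_mul hq.le, hsθ,
      show 1 / n * (n * θ) = θ by field_simp, show 1 / n * -(n * (1 - θ)) = θ - 1 by field_simp; ring,
      Real.div_rpow hA.le hG.le, Real.div_rpow hA.le hG.le] at h1
    have h2 : G ^ (1 - θ) = G / G ^ θ := by rw [Real.rpow_sub hG, Real.rpow_one]
    have h3 : A ^ θ = A ^ (θ - 1) * A := by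
      conv_rhs => rw [← Real.rpow_one A]
      rw [← Real.rpow_mul hA.le, one_mul, ← Real.rpow_add hA]; ring_nf
    have h4 : (G ^ (θ - 1))⁻¹ = G ^ (1 - θ) := by rw [← Real.rpow_neg hG.le]; ring_nf
    refine h1.trans_eq ?_
    rw [div_eq_mul_inv (A ^ (θ - 1)), h4]
    rw [add_mul, add_mul, one_mul, h3, h2]
    ring

theorem norm_rpow_eq_gagliardo {N : ℕ} {s p : ℝ} [Fact (p ∈ Set.Ioo 1 ((N : ℝ) / s))]
    (u : HomSobolev N s p) :
    ENNReal.ofReal (‖u‖ ^ p) = gagliardoLIntegral s p u := by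
  have hp0 := exp_pos N s p
  rw [norm_def, ← Real.rpow_mul ENNReal.toReal_nonneg, one_div_mul_cancel hp0.ne', Real.rpow_one,
    ENNReal.ofReal_toReal (gagliardo_lt_top u).ne]

theorem ae_gagliardoDensity_lt_top {N : ℕ} {s p : ℝ} [Fact (p ∈ Set.Ioo 1 ((N : ℝ) / s))]
    (u : HomSobolev N s p) :
    ∀ᵐ x, gagliardoDensity s p u x < ∞ := by
  have hu := Lp.aestronglyMeasurable (toLp N s p u)
  refine ae_lt_top' (aemeasurable_gagliardoDensity (exp_pos N s p) hu) ?_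
  rw [lintegral_gagliardoDensity (exp_pos N s p) hu]
  exact (gagliardo_lt_top u).ne

section Sobolev

variable {N : ℕ} {s p : ℝ} [hs : Fact (s ∈ Set.Ioo (0 : ℝ) 1)]
  [hp : Fact (p ∈ Set.Ioo 1 ((N : ℝ) / s))]

theorem lintegral_enorm_rpow_critExp (u : HomSobolev N s p) :
    ∫⁻ x, ‖u x‖ₑ ^ critExp N s p = ENNReal.ofReal (‖toLp N s p u‖ ^ critExp N s p) := by
  have hm : 0 < critExp N s p := one_pos.trans (one_lt_critExp N s p)
  rw [← ENNReal.ofReal_rpow_of_nonneg (norm_nonneg _) hm.le, ofReal_norm, Lp.enorm_def,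
    eLpNorm_eq_lintegral_rpow_enorm_toReal (by simpa using hm) ENNReal.ofReal_ne_top,
    ENNReal.toReal_ofReal hm.le, ← ENNReal.rpow_mul, one_div_mul_cancel hm.ne', ENNReal.rpow_one]

theorem abs_cellMean_le (u : HomSobolev N s p) {r : ℝ} (hr : 0 < r) (k : Fin N → ℤ) :
    |cellMean r k u| ≤ r ^ (-(N / critExp N s p)) * ‖toLp N s p u‖ := by
  have hm1 := one_lt_critExp N s p
  have hm : 0 < critExp N s p := by linarith
  have h1 := enorm_cellMean_rpow_le hr hm1.le k (Lp.aestronglyMeasurable (toLp N s p u))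
  rw [lintegral_enorm_rpow_critExp, ← ENNReal.ofReal_mul (by positivity), ← ofReal_norm,
    ENNReal.ofReal_rpow_of_nonneg (norm_nonneg _) hm.le,
    ENNReal.ofReal_le_ofReal_iff (by positivity)] at h1
  rw [← Real.rpow_le_rpow_iff (abs_nonneg _) (by positivity) hm,
    Real.mul_rpow (by positivity) (norm_nonneg _), ← Real.rpow_mul hr.le, neg_mul,
    div_mul_cancel₀ _ hm.ne']
  exact h1

theorem integrable_cell (u : HomSobolev N s p) {r : ℝ} (hr : 0 < r) (k : Fin N → ℤ) :
    Integrable u (ProbabilityTheory.cond volume (cellSet r k)) :=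
  integrable_cond_cellSet hr (one_lt_critExp N s p).le k (Lp.memLp (toLp N s p u))

variable (N s p) in
/-- The fractional Sobolev inequality. -/
theorem exists_norm_toLp_le : ∃ C, 0 ≤ C ∧ ∀ u : HomSobolev N s p, ‖toLp N s p u‖ ≤ C * ‖u‖ := by
  have hm1 := one_lt_critExp N s p
  have hm : 0 < critExp N s p := by linarith
  have hp0 := exp_pos N s p
  have hN := dim_pos N s p
  have hs0 := hs.out.1
  set m := critExp N s p with hmdef
  set θ := s * p / N with hθ
  have hθ1 : θ < 1 := by rw [hθ, div_lt_one hN]; exact mul_lt_dim N s p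
  have hmθ : m * (1 - θ) = p := critExp_mul N s p
  set K : ℝ := (√N ^ (N + s * p)) ^ (1 / p) with hK
  have hK0 : 0 ≤ K := by positivity
  refine ⟨(K + 1) ^ (m / p), by positivity, fun u => ?_⟩
  set A := ‖toLp N s p u‖ with hA
  rcases (norm_nonneg (toLp N s p u)).eq_or_lt with hA0 | hA0
  · rw [hA, ← hA0]; positivity
  rw [← hA] at hA0
  have hu := Lp.aestronglyMeasurable (toLp N s p u)
  -- The cell size is optimised separately for each `x`. Since `m * (1 - θ) = p`, the density
  -- appears to the power one and can be integrated exactly.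
  have hpt : ∀ᵐ x, ‖u x‖ₑ ^ m ≤
      ENNReal.ofReal ((K + 1) ^ m * A ^ (θ * m)) * gagliardoDensity s p u x := by
    filter_upwards [ae_gagliardoDensity_lt_top u] with x hx
    set g := (gagliardoDensity s p u x).toReal with hg
    have hg0 : 0 ≤ g := ENNReal.toReal_nonneg
    have hgx : gagliardoDensity s p u x = ENNReal.ofReal g := (ENNReal.ofReal_toReal hx.ne).symm
    have h1 : ∀ r : ℝ, 0 < r → |u x| ≤ K * r ^ s * g ^ (1 / p) + r ^ (-(N / p * (1 - θ))) * A := by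
      intro r hr
      have h2 := enorm_sub_cellMean_rpow_le hr hs0 hp.out.1 x (integrable_cell u hr _)
      rw [hgx, ← ENNReal.ofReal_mul (by positivity), ← ofReal_norm,
        ENNReal.ofReal_rpow_of_nonneg (norm_nonneg _) hp0.le,
        ENNReal.ofReal_le_ofReal_iff (by positivity)] at h2
      have h3 : |u x - cellMean r (cell r x) u| ≤ K * r ^ s * g ^ (1 / p) := by
        rw [← Real.rpow_le_rpow_iff (abs_nonneg _) (by positivity) hp0,
          Real.mul_rpow (by positivity) (by positivity), Real.mul_rpow hK0 (by positivity), hK,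
          ← Real.rpow_mul (by positivity), ← Real.rpow_mul hr.le, ← Real.rpow_mul hg0,
          one_div_mul_cancel hp0.ne', Real.rpow_one, Real.rpow_one]
        exact h2
      have h4 := abs_cellMean_le u hr (cell r x)
      rw [dim_div_critExp] at h4
      have h5 := abs_add_le (u x - cellMean r (cell r x) u) (cellMean r (cell r x) u)
      rw [sub_add_cancel] at h5
      linarith
    have h2 := le_rpow_mul_rpow_of_forall (by positivity) hA0 (div_pos hN hp0)
      (by rw [hθ]; field_simp) hθ1 h1
    have h3 := Real.rpow_le_rpow (abs_nonneg _) h2 hm.le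
    rw [Real.mul_rpow (by positivity) (by positivity), Real.mul_rpow (by positivity) (by positivity),
      ← Real.rpow_mul hA0.le, ← Real.rpow_mul (by positivity), ← Real.rpow_mul hg0,
      mul_comm (1 - θ), hmθ, one_div_mul_cancel hp0.ne', Real.rpow_one] at h3
    rw [hgx, ← ENNReal.ofReal_mul (by positivity), ← ofReal_norm,
      ENNReal.ofReal_rpow_of_nonneg (norm_nonneg _) hm.le]
    exact ENNReal.ofReal_le_ofReal h3
  have h1 := lintegral_mono_ae hpt
  rw [lintegral_const_mul' _ _ ENNReal.ofReal_ne_top, lintegral_enorm_rpow_critExp,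
    lintegral_gagliardoDensity hp0 hu, ← norm_rpow_eq_gagliardo,
    ← ENNReal.ofReal_mul (by positivity), ENNReal.ofReal_le_ofReal_iff (by positivity),
    ← hA, ← hmdef] at h1
  -- The critical norm `A` also occurs on the right; it is finite and positive, so the factor `A ^
  -- (θ * m)` cancels.
  have h2 : A ^ m = A ^ (θ * m) * A ^ p := by
    rw [← Real.rpow_add hA0, ← hmθ]; ring_nf
  rw [h2, mul_right_comm, mul_comm (A ^ (θ * m))] at h1
  have h3 := le_of_mul_le_mul_right h1 (by positivity)
  rw [← Real.rpow_le_rpow_iff (norm_nonneg _) (by positivity) hp0,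
    Real.mul_rpow (by positivity) (norm_nonneg _), ← Real.rpow_mul (by positivity),
    div_mul_cancel₀ _ hp0.ne']
  exact h3

end Sobolev

/-! ### Almost everywhere compactness of bounded sequences -/

section Compactness

/-- On a finite measure `L^p` bounds become `L^1` bounds; `ν ≤ volume` carries estimates to `ν`, and
absolute continuity carries almost everywhere statements back. -/
theorem exists_finite_measure_le (N : ℕ) : ∃ ν : Measure (Space N),
    IsFiniteMeasure ν ∧ ν ≤ volume ∧ (volume : Measure (Space N)) ≪ ν := by
  set w : Space N → ℝ≥0∞ := fun x => ENNReal.ofReal ((1 + ‖x‖) ^ (-((N : ℝ) + 1))) with hw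
  have hwm : Measurable w := by fun_prop
  refine ⟨volume.withDensity w, ⟨?_⟩, ?_, ?_⟩
  · rw [withDensity_apply _ MeasurableSet.univ, Measure.restrict_univ]
    exact finite_integral_one_add_norm (by simp)
  · conv_rhs => rw [← withDensity_one (μ := (volume : Measure (Space N)))]
    refine withDensity_mono (ae_of_all _ fun x => ?_)
    rw [hw, Pi.one_apply, ENNReal.ofReal_le_one]
    exact Real.rpow_le_one_of_one_le_of_nonpos (by linarith [norm_nonneg x])
      (by linarith [(Nat.cast_nonneg N : (0 : ℝ) ≤ N)])
  · refine withDensity_absolutelyContinuous' hwm.aemeasurable (ae_of_all _ fun x => ?_)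
    rw [hw, Ne, ENNReal.ofReal_eq_zero, not_le]
    have : 0 ≤ ‖x‖ := norm_nonneg x
    positivity

theorem ae_tendsto_diffQuot {N : ℕ} {s p : ℝ} {u : ℕ → Space N → ℝ} {w : Space N → ℝ}
    (h : ∀ᵐ x, Tendsto (fun j => u j x) atTop (𝓝 (w x))) :
    ∀ᵐ z, Tendsto (fun j => diffQuot s p (u j) z) atTop (𝓝 (diffQuot s p w z)) := by
  have h1 := (Measure.quasiMeasurePreserving_fst
    (μ := (volume : Measure (Space N))) (ν := (volume : Measure (Space N)))).ae h
  have h2 := (Measure.quasiMeasurePreserving_snd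
    (μ := (volume : Measure (Space N))) (ν := (volume : Measure (Space N)))).ae h
  rw [Measure.volume_eq_prod]
  filter_upwards [h1, h2] with z hz1 hz2
  exact (hz1.sub hz2).div_const _

variable {N : ℕ} {s p : ℝ} [hs : Fact (s ∈ Set.Ioo (0 : ℝ) 1)]
  [hp : Fact (p ∈ Set.Ioo 1 ((N : ℝ) / s))]

theorem measurable_cellMean_cell (r : ℝ) (u : Space N → ℝ) :
    Measurable fun x => cellMean r (cell r x) u :=
  (measurable_of_countable fun k => cellMean r k u).comp (measurable_cell r)

variable (N s p) in
-- The point is uniformity: on a bounded set of `u`, the step functions on the grid approximate at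
-- the common rate `r ^ s`.
theorem exists_eLpNorm_sub_cellMean_le : ∃ K : ℝ, 0 ≤ K ∧ ∀ (u : HomSobolev N s p) (r : ℝ), 0 < r →
    eLpNorm (fun x => u x - cellMean r (cell r x) u) (ENNReal.ofReal p) volume ≤
      ENNReal.ofReal (K * r ^ s * ‖u‖) := by
  have hp0 := exp_pos N s p
  refine ⟨(√N ^ (N + s * p)) ^ (1 / p), by positivity, fun u r hr => ?_⟩
  have h1 := lintegral_mono (μ := volume) fun x =>
    enorm_sub_cellMean_rpow_le hr hs.out.1 hp.out.1 x (integrable_cell u hr _)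
  rw [lintegral_const_mul' _ _ ENNReal.ofReal_ne_top,
    lintegral_gagliardoDensity hp0 (Lp.aestronglyMeasurable _), ← norm_rpow_eq_gagliardo,
    ← ENNReal.ofReal_mul (by positivity)] at h1
  rw [eLpNorm_eq_lintegral_rpow_enorm_toReal (by simpa using hp0) ENNReal.ofReal_ne_top,
    ENNReal.toReal_ofReal hp0.le]
  refine (ENNReal.rpow_le_rpow h1 (by positivity)).trans_eq ?_
  rw [ENNReal.ofReal_rpow_of_nonneg (by positivity) (by positivity),
    Real.mul_rpow (by positivity) (by positivity), Real.mul_rpow (by positivity) (by positivity),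
    ← Real.rpow_mul hr.le, ← Real.rpow_mul (norm_nonneg _), mul_one_div_cancel hp0.ne',
    Real.rpow_one, mul_assoc s, mul_one_div_cancel hp0.ne', mul_one]

/-- The means form a sequence in a countable product of compact intervals, so sequential compactness
replaces a diagonal argument. -/
theorem exists_subseq_tendsto_cellMean (u : ℕ → HomSobolev N s p) {M : ℝ}
    (hM : ∀ j, ‖toLp N s p (u j)‖ ≤ M) (r : ℕ → ℝ) (hr : ∀ n, 0 < r n) :
    ∃ φ : ℕ → ℕ, StrictMono φ ∧ ∃ L : ℕ × (Fin N → ℤ) → ℝ,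
      ∀ i, Tendsto (fun j => cellMean (r i.1) i.2 (u (φ j))) atTop (𝓝 (L i)) := by
  set B : ℕ → ℝ := fun n => r n ^ (-(N / critExp N s p)) * M
  have hc : IsCompact (Set.pi Set.univ fun i : ℕ × (Fin N → ℤ) => Set.Icc (-B i.1) (B i.1)) :=
    isCompact_univ_pi fun _ => isCompact_Icc
  obtain ⟨L, -, φ, hφ, hL⟩ := hc.tendsto_subseq
    (x := fun j (i : ℕ × (Fin N → ℤ)) => cellMean (r i.1) i.2 (u j)) fun j i _ => by
      refine abs_le.1 ((abs_cellMean_le (u j) (hr i.1) i.2).trans ?_)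
      have := (hr i.1).le
      exact mul_le_mul_of_nonneg_left (hM j) (by positivity)
  exact ⟨φ, hφ, L, fun i => (tendsto_pi_nhds.1 hL) i⟩

/-- Along one subsequence the step approximations converge on every grid, and they are uniformly
close to the functions on fine grids. Hence the subsequence is Cauchy in `L^1(ν)`, and a further one
converges almost everywhere. -/
theorem exists_subseq_tendsto_ae (u : ℕ → HomSobolev N s p) {M : ℝ} (hM : ∀ j, ‖u j‖ ≤ M) :
    ∃ φ : ℕ → ℕ, StrictMono φ ∧ ∃ w : Space N → ℝ, AEStronglyMeasurable w volume ∧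
      ∀ᵐ x, Tendsto (fun j => u (φ j) x) atTop (𝓝 (w x)) := by
  have hp0 := exp_pos N s p
  have hM0 : 0 ≤ M := (norm_nonneg _).trans (hM 0)
  obtain ⟨C, hC0, hC⟩ := exists_norm_toLp_le N s p
  obtain ⟨K, hK0, hK⟩ := exists_eLpNorm_sub_cellMean_le N s p
  obtain ⟨ν, hν, hνle, hac⟩ := exists_finite_measure_le N
  have hA : ∀ j, ‖toLp N s p (u j)‖ ≤ C * M := fun j =>
    (hC _).trans (mul_le_mul_of_nonneg_left (hM j) hC0)
  set r : ℕ → ℝ := fun n => 1 / ((n : ℝ) + 1) with hr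
  have hr0 : ∀ n, 0 < r n := fun n => by positivity
  obtain ⟨φ, hφ, L, hL⟩ := exists_subseq_tendsto_cellMean u hA r hr0
  set e : ℕ → Space N → ℝ := fun j => u (φ j) with he
  set b : ℕ → Space N → ℝ := fun n x => L (n, cell (r n) x) with hb
  have hem : ∀ j, AEStronglyMeasurable (e j) ν := fun j =>
    (Lp.aestronglyMeasurable _).mono_measure hνle
  have hbm : ∀ n, Measurable (b n) := fun n =>
    (measurable_of_countable fun k => L (n, k)).comp (measurable_cell (r n))
  have heL : ∀ j, MemLp (e j) 1 ν := fun j =>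
    ((Lp.memLp (toLp N s p (u (φ j)))).mono_measure hνle).mono_exponent
      (by simpa using ENNReal.ofReal_le_ofReal (one_lt_critExp N s p).le)
  -- The norm bound for the inclusion of `L^p(ν)` in `L^1(ν)`.
  set D : ℝ≥0∞ := ν Set.univ ^ (1 / (1 : ℝ≥0∞).toReal - 1 / (ENNReal.ofReal p).toReal) with hD
  have hDtop : D ≠ ∞ := by
    refine ENNReal.rpow_ne_top_of_nonneg ?_ (measure_ne_top _ _)
    rw [ENNReal.toReal_ofReal hp0.le, ENNReal.toReal_one, one_div_one, sub_nonneg,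
      div_le_one hp0]
    exact hp.out.1.le
  have h1 : ∀ n j, eLpNorm (fun x => e j x - cellMean (r n) (cell (r n) x) (e j)) 1 ν ≤
      ENNReal.ofReal (K * r n ^ s * M) * D := fun n j => by
    refine (eLpNorm_le_eLpNorm_mul_rpow_measure_univ (q := ENNReal.ofReal p)
      (by simpa using ENNReal.ofReal_le_ofReal hp.out.1.le)
      ((hem j).sub (measurable_cellMean_cell _ _).aestronglyMeasurable)).trans ?_
    gcongr
    refine (eLpNorm_mono_measure _ hνle).trans ((hK _ _ (hr0 n)).trans ?_)
    refine ENNReal.ofReal_le_ofReal ?_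
    have := (hr0 n).le
    gcongr
    exact hM _
  have h2 : ∀ n, Tendsto (fun j => eLpNorm (fun x =>
      cellMean (r n) (cell (r n) x) (e j) - b n x) 1 ν) atTop (𝓝 0) := fun n => by
    simp_rw [eLpNorm_one_eq_lintegral_enorm, ← ofReal_norm]
    refine tendsto_lintegral_norm_of_dominated_convergence
      (bound := fun _ => r n ^ (-(N / critExp N s p)) * (C * M))
      (fun j => (measurable_cellMean_cell _ _).aestronglyMeasurable)
      (hasFiniteIntegral_const _) (fun j => ae_of_all _ fun x => ?_)
      (ae_of_all _ fun x => hL (n, cell (r n) x))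
    have := (hr0 n).le
    exact (abs_cellMean_le _ (hr0 n) _).trans
      (mul_le_mul_of_nonneg_left (hA _) (by positivity))
  have h3 : Tendsto (fun n => ENNReal.ofReal (K * r n ^ s * M) * D) atTop (𝓝 0) := by
    have hrt : Tendsto (fun n => r n ^ s) atTop (𝓝 0) := by
      have := (tendsto_one_div_add_atTop_nhds_zero_nat (𝕜 := ℝ)).rpow_const
        (Or.inr hs.out.1.le : (0 : ℝ) ≠ 0 ∨ 0 ≤ s)
      rwa [Real.zero_rpow hs.out.1.ne'] at this
    have h4 := ENNReal.Tendsto.mul_const (b := D)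
      (ENNReal.tendsto_ofReal ((hrt.const_mul K).mul_const M)) (Or.inr hDtop)
    simpa using h4
  have hcau : CauchySeq fun j => (heL j).toLp (e j) := by
    rw [EMetric.cauchySeq_iff]
    intro ε hε
    have hε4 : 0 < ε / 4 := ENNReal.div_pos hε.ne' (by simp)
    obtain ⟨n, hn⟩ := (h3.eventually (gt_mem_nhds hε4)).exists
    obtain ⟨J, hJ⟩ := eventually_atTop.1 ((h2 n).eventually (gt_mem_nhds hε4))
    -- The grid `n` is fixed first, from the error that is uniform in `j`; only then is `J` chosen.
    have h5 : ∀ j, J ≤ j → eLpNorm (e j - b n) 1 ν < ε / 2 := fun j hj => by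
      have h6 : e j - b n = (fun x => e j x - cellMean (r n) (cell (r n) x) (e j)) +
          fun x => cellMean (r n) (cell (r n) x) (e j) - b n x := by
        ext x; simp
      rw [h6]
      have hcm : AEStronglyMeasurable (fun x => cellMean (r n) (cell (r n) x) (e j)) ν :=
        (measurable_cellMean_cell _ _).aestronglyMeasurable
      refine (eLpNorm_add_le ((hem j).sub hcm)
        (hcm.sub (hbm n).aestronglyMeasurable) le_rfl).trans_lt ?_
      refine (ENNReal.add_lt_add ((h1 n j).trans_lt hn) (hJ j hj)).trans_eq ?_
      rw [← two_mul, ← mul_div_assoc]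
      rw [ENNReal.div_eq_div_iff (by simp) (by simp) (by simp) (by simp)]
      ring
    refine ⟨J, fun i hi j hj => ?_⟩
    rw [Lp.edist_toLp_toLp]
    have h6 : e i - e j = (e i - b n) - (e j - b n) := by ext x; simp
    rw [h6]
    refine (eLpNorm_sub_le ((hem i).sub (hbm n).aestronglyMeasurable)
      ((hem j).sub (hbm n).aestronglyMeasurable) le_rfl).trans_lt ?_
    exact (ENNReal.add_lt_add (h5 i hi) (h5 j hj)).trans_eq (ENNReal.add_halves ε)
  obtain ⟨w, hw⟩ := cauchySeq_tendsto_of_complete hcau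
  obtain ⟨ψ, hψ, hψlim⟩ := (tendstoInMeasure_of_tendsto_Lp hw).exists_seq_tendsto_ae
  refine ⟨φ ∘ ψ, hφ.comp hψ, w, (Lp.stronglyMeasurable w).aestronglyMeasurable, hac.ae_le ?_⟩
  filter_upwards [hψlim, ae_all_iff.2 fun j => (heL j).coeFn_toLp] with x hx hx'
  exact hx.congr fun j => hx' (ψ j)

/-- Every bounded sequence in `D^{s,p}(ℝ^N)` has a subsequence that converges almost everywhere
to an element of `D^{s,p}(ℝ^N)`. -/
theorem exists_subseq_tendsto_ae_homSobolev (u : ℕ → HomSobolev N s p) {M : ℝ}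
    (hM : ∀ j, ‖u j‖ ≤ M) :
    ∃ φ : ℕ → ℕ, StrictMono φ ∧ ∃ w : HomSobolev N s p,
      ∀ᵐ x, Tendsto (fun j => u (φ j) x) atTop (𝓝 (w x)) := by
  obtain ⟨φ, hφ, w, hwm, hw⟩ := exists_subseq_tendsto_ae u hM
  obtain ⟨C, hC0, hC⟩ := exists_norm_toLp_le N s p
  have hA : ∀ j, ‖toLp N s p (u j)‖ ≤ C * M := fun j =>
    (hC _).trans (mul_le_mul_of_nonneg_left (hM j) hC0)
  -- Fatou's lemma bounds both the critical norm and the seminorm of the limit.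
  have h1 : MemLp w (ENNReal.ofReal (critExp N s p)) volume := by
    refine ⟨hwm, (Lp.eLpNorm_lim_le_liminf_eLpNorm
      (fun j => Lp.aestronglyMeasurable (toLp N s p (u (φ j)))) w hw).trans_lt ?_⟩
    refine lt_of_le_of_lt (b := ENNReal.ofReal (C * M)) (liminf_le_of_frequently_le'
      (Frequently.of_forall fun j => ?_)) ENNReal.ofReal_lt_top
    rw [← Lp.enorm_def, ← ofReal_norm]
    exact ENNReal.ofReal_le_ofReal (hA _)
  have h2 : gagliardoLIntegral s p (h1.toLp w) < ∞ := by
    rw [← memLp_diffQuot_iff s (exp_pos N s p) (Lp.aestronglyMeasurable _),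
      memLp_congr_ae (diffQuot_congr s p h1.coeFn_toLp)]
    refine ⟨aestronglyMeasurable_diffQuot s p hwm, (Lp.eLpNorm_lim_le_liminf_eLpNorm
      (fun j => (memLp_diffQuot (u (φ j))).1) _ (ae_tendsto_diffQuot hw)).trans_lt ?_⟩
    refine lt_of_le_of_lt (b := ENNReal.ofReal M) (liminf_le_of_frequently_le'
      (Frequently.of_forall fun j => ?_)) ENNReal.ofReal_lt_top
    rw [← ENNReal.ofReal_toReal (memLp_diffQuot (u (φ j))).2.ne, ← norm_eq_eLpNorm]
    exact ENNReal.ofReal_le_ofReal (hM _)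
  refine ⟨φ, hφ, ⟨h1.toLp w, h2⟩, ?_⟩
  filter_upwards [hw, h1.coeFn_toLp] with x hx hx'
  change Tendsto _ _ (𝓝 (h1.toLp w x))
  rwa [hx']

end Compactness

/-! ### Limits along almost everywhere convergent bounded sequences in `L^r` -/

section LpLimits

variable {X : Type*} [MeasurableSpace X] {μ : Measure X} {r : ℝ} [Fact (1 ≤ ENNReal.ofReal r)]

theorem integral_abs_rpow_le_of_norm_le (hr : 0 < r) {f : Lp ℝ (ENNReal.ofReal r) μ} {M : ℝ}
    (hM : ‖f‖ ≤ M) : ∫ x, |f x| ^ r ∂μ ≤ M ^ r := by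
  rw [← norm_rpow_eq_integral hr]
  exact Real.rpow_le_rpow (norm_nonneg _) hM hr.le

theorem tendsto_powDeriv (hr : 1 < r) {f : ℕ → Lp ℝ (ENNReal.ofReal r) μ}
    {f₀ : Lp ℝ (ENNReal.ofReal r) μ} {M : ℝ} (hM : ∀ j, ‖f j‖ ≤ M)
    (hlim : ∀ᵐ x ∂μ, Tendsto (fun j => f j x) atTop (𝓝 (f₀ x))) (g : Lp ℝ (ENNReal.ofReal r) μ) :
    Tendsto (fun j => powDeriv hr (f j) g) atTop (𝓝 (powDeriv hr f₀ g)) := by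
  simp_rw [powDeriv_apply]
  exact tendsto_integral_signedPow_mul hr (fun j => Lp.memLp (f j)) (Lp.memLp f₀) (Lp.memLp g)
    hlim fun j => integral_abs_rpow_le_of_norm_le (by linarith) (hM j)

theorem tendsto_norm_rpow_sub_norm_sub_rpow (hr : 1 < r) {f : ℕ → Lp ℝ (ENNReal.ofReal r) μ}
    {f₀ : Lp ℝ (ENNReal.ofReal r) μ} {M : ℝ} (hM : ∀ j, ‖f j‖ ≤ M)
    (hlim : ∀ᵐ x ∂μ, Tendsto (fun j => f j x) atTop (𝓝 (f₀ x))) :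
    Tendsto (fun j => ‖f j‖ ^ r - ‖f j - f₀‖ ^ r) atTop (𝓝 (‖f₀‖ ^ r)) := by
  have hr0 : 0 < r := by linarith
  have h1 : ∀ j, ∫ x, |f j x - f₀ x| ^ r ∂μ = ‖f j - f₀‖ ^ r := fun j => by
    rw [norm_rpow_eq_integral hr0]
    refine integral_congr_ae ?_
    filter_upwards [Lp.coeFn_sub (f j) f₀] with x hx
    rw [hx, Pi.sub_apply]
  have h2 := tendsto_integral_abs_rpow_sub (M := (M + ‖f₀‖) ^ r) hr (fun j => Lp.memLp (f j))
    (Lp.memLp f₀) hlim fun j => by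
      rw [h1]
      refine Real.rpow_le_rpow (norm_nonneg _) ((norm_sub_le _ _).trans ?_) hr0.le
      linarith [hM j]
  simpa only [h1, ← norm_rpow_eq_integral hr0] using h2

end LpLimits

/-! ### The operators whose norms make up the energy -/

section Operators

theorem gagliardoIntegrand_eq {N : ℕ} (s : ℝ) {p : ℝ} (hp : 0 < p) (u : Space N → ℝ)
    (z : Space N × Space N) : gagliardoIntegrand s p u z = |diffQuot s p u z| ^ p := by
  have h := enorm_diffQuot_rpow s hp u z
  rw [← ofReal_norm, ENNReal.ofReal_rpow_of_nonneg (norm_nonneg _) hp.le] at h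
  exact ((ENNReal.ofReal_eq_ofReal_iff (by positivity)
    (by unfold gagliardoIntegrand; positivity)).1 h).symm

theorem integral_gagliardoIntegrand {N : ℕ} {s p : ℝ} [Fact (p ∈ Set.Ioo 1 ((N : ℝ) / s))]
    (u : HomSobolev N s p) :
    ∫ z, gagliardoIntegrand s p u z = ‖u‖ ^ p := by
  have hp0 := exp_pos N s p
  simp_rw [gagliardoIntegrand_eq s hp0]
  have h := (memLp_diffQuot u).eLpNorm_eq_integral_rpow_norm (by simpa using hp0)
    ENNReal.ofReal_ne_top
  rw [ENNReal.toReal_ofReal hp0.le] at h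
  have h0 : 0 ≤ ∫ z, ‖diffQuot s p u z‖ ^ p := integral_nonneg fun x => by positivity
  rw [norm_eq_eLpNorm, h, ENNReal.toReal_ofReal (by positivity), ← Real.rpow_mul h0,
    inv_mul_cancel₀ hp0.ne', Real.rpow_one]
  rfl

variable {N : ℕ} {s p : ℝ} [hs : Fact (s ∈ Set.Ioo (0 : ℝ) 1)]
  [hp : Fact (p ∈ Set.Ioo 1 ((N : ℝ) / s))]

/-- Turns each ingredient of the energy into a bounded operator to some `L^r`, so that derivatives
follow from the chain rule. -/
theorem exists_clm_toLp {X : Type*} [MeasurableSpace X] {μ : Measure X} {r : ℝ}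
    [Fact (1 ≤ ENNReal.ofReal r)] (hr : 0 < r) (T : HomSobolev N s p → X → ℝ)
    (hT : ∀ u, MemLp (T u) (ENNReal.ofReal r) μ)
    (hadd : ∀ u v, T (u + v) =ᵐ[μ] T u + T v)
    (hsmul : ∀ (k : ℝ) u, T (k • u) =ᵐ[μ] k • T u) {C : ℝ} (hC0 : 0 ≤ C)
    (hC : ∀ u, ∫ x, |T u x| ^ r ∂μ ≤ (C * ‖u‖) ^ r) :
    ∃ F : HomSobolev N s p →L[ℝ] Lp ℝ (ENNReal.ofReal r) μ, ∀ u, F u =ᵐ[μ] T u := by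
  let F₀ : HomSobolev N s p →ₗ[ℝ] Lp ℝ (ENNReal.ofReal r) μ :=
    { toFun := fun u => (hT u).toLp (T u)
      map_add' := fun u v => by
        rw [← MemLp.toLp_add (hT u) (hT v)]
        exact MemLp.toLp_congr _ _ (hadd u v)
      map_smul' := fun k u => by
        rw [RingHom.id_apply, ← MemLp.toLp_const_smul k (hT u)]
        exact MemLp.toLp_congr _ _ (hsmul k u) }
  refine ⟨F₀.mkContinuous C fun u => ?_, fun u => (hT u).coeFn_toLp⟩
  rw [← Real.rpow_le_rpow_iff (norm_nonneg _) (by positivity) hr, norm_rpow_eq_integral hr]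
  refine le_trans (le_of_eq (integral_congr_ae ?_)) (hC u)
  filter_upwards [(hT u).coeFn_toLp] with x hx
  exact congrArg (fun t : ℝ => |t| ^ r) hx

variable (N s p) in
theorem exists_clm_diffQuot [Fact (1 ≤ ENNReal.ofReal p)] :
    ∃ F : HomSobolev N s p →L[ℝ] Lp ℝ (ENNReal.ofReal p) (volume : Measure (Space N × Space N)),
      (∀ u, F u =ᵐ[volume] diffQuot s p u) ∧ ∀ u, ‖F u‖ = ‖u‖ := by
  have hp0 := exp_pos N s p
  obtain ⟨F, hF⟩ := exists_clm_toLp (μ := (volume : Measure (Space N × Space N))) hp0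
    (fun u : HomSobolev N s p => diffQuot s p u) memLp_diffQuot
    (fun u v => (diffQuot_congr s p (coe_add u v)).trans (by rw [diffQuot_add]))
    (fun k u => (diffQuot_congr s p (coe_smul k u)).trans (by rw [diffQuot_smul]))
    zero_le_one fun u => by
      simp_rw [← gagliardoIntegrand_eq s hp0]
      rw [integral_gagliardoIntegrand, one_mul]
  refine ⟨F, hF, fun u => ?_⟩
  rw [Lp.norm_def, eLpNorm_congr_ae (hF u), norm_eq_eLpNorm]

theorem integrable_abs_rpow_critExp (u : HomSobolev N s p) :
    Integrable (fun x => |u x| ^ critExp N s p) volume :=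
  MemLp.integrable_abs_rpow (one_pos.trans (one_lt_critExp N s p)) (Lp.memLp (toLp N s p u))

theorem norm_toLp_rpow (u : HomSobolev N s p) :
    ‖toLp N s p u‖ ^ critExp N s p = ∫ x, |u x| ^ critExp N s p :=
  norm_rpow_eq_integral (one_pos.trans (one_lt_critExp N s p)) _

theorem weight_le_add {a c ε C t r m : ℝ} (ha : 0 ≤ a) (hac : a ≤ c)
    (hε : 0 ≤ ε) (ht : 0 ≤ t) (h : t ^ r ≤ ε * t ^ m + C) :
    a * t ^ r ≤ ε * c * t ^ m + C * a := by
  have h1 := mul_le_mul_of_nonneg_left h ha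
  have h2 : a * (ε * t ^ m) ≤ c * (ε * t ^ m) := by gcongr
  linarith

/-! ### Weighted integrals with subcritical powers -/

section Weight

variable {a : Space N → ℝ} {c : ℝ} {r : ℝ}

theorem integrable_weight_mul (hr : 0 < r) (hrm : r < critExp N s p)
    (hai : Integrable a volume) (hab : ∀ᵐ x, 0 ≤ a x ∧ a x ≤ c) (u : HomSobolev N s p) :
    Integrable (fun x => a x * |u x| ^ r) volume := by
  obtain ⟨C, hC0, hC⟩ := exists_rpow_le_add hr hrm one_pos
  refine (((integrable_abs_rpow_critExp u).const_mul (1 * c)).add (hai.const_mul C)).mono' ?_ ?_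
  · exact (hai.1.aemeasurable.mul ((Lp.aestronglyMeasurable
      (toLp N s p u)).norm.aemeasurable.pow_const _)).aestronglyMeasurable
  · filter_upwards [hab] with x hx
    rw [Real.norm_eq_abs, abs_of_nonneg (mul_nonneg hx.1 (by positivity))]
    exact weight_le_add hx.1 hx.2 zero_le_one (abs_nonneg _) (hC _ (abs_nonneg _))

theorem exists_integral_weight_mul_le (hr : 0 < r) (hrm : r < critExp N s p)
    (hai : Integrable a volume) (hab : ∀ᵐ x, 0 ≤ a x ∧ a x ≤ c) {ε : ℝ} (hε : 0 < ε) :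
    ∃ C, 0 ≤ C ∧ ∀ u : HomSobolev N s p,
      ∫ x, a x * |u x| ^ r ≤ ε * c * ‖toLp N s p u‖ ^ critExp N s p + C := by
  obtain ⟨C, hC0, hC⟩ := exists_rpow_le_add hr hrm hε
  have ha0 : 0 ≤ ∫ x, a x := integral_nonneg_of_ae (hab.mono fun x hx => hx.1)
  refine ⟨C * ∫ x, a x, mul_nonneg hC0 ha0, fun u => ?_⟩
  rw [norm_toLp_rpow, ← integral_const_mul, ← integral_const_mul,
    ← integral_add ((integrable_abs_rpow_critExp u).const_mul _) (hai.const_mul C)]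
  refine integral_mono_ae (integrable_weight_mul hr hrm hai hab u)
    (((integrable_abs_rpow_critExp u).const_mul _).add (hai.const_mul C)) ?_
  filter_upwards [hab] with x hx
  exact weight_le_add hx.1 hx.2 hε.le (abs_nonneg _) (hC _ (abs_nonneg _))

/-- On the unit sphere the inhomogeneous bound and Sobolev's inequality give a constant; homogeneity
of degree `r` extends it. -/
theorem exists_integral_weight_mul_le_rpow (hr : 0 < r) (hrm : r < critExp N s p)
    (hai : Integrable a volume) (hab : ∀ᵐ x, 0 ≤ a x ∧ a x ≤ c) :
    ∃ D, 0 ≤ D ∧ ∀ u : HomSobolev N s p, ∫ x, a x * |u x| ^ r ≤ (D * ‖u‖) ^ r := by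
  obtain ⟨C, hC0, hC⟩ := exists_integral_weight_mul_le (s := s) (p := p) hr hrm hai hab one_pos
  obtain ⟨K, hK0, hK⟩ := exists_norm_toLp_le N s p
  have hm := one_lt_critExp N s p
  have hc : 0 ≤ c := by
    obtain ⟨x, hx⟩ := hab.exists
    exact hx.1.trans hx.2
  set B := 1 * c * K ^ critExp N s p + C with hB
  have hB0 : 0 ≤ B := by positivity
  refine ⟨B ^ (1 / r), by positivity, fun u => ?_⟩
  rw [Real.mul_rpow (by positivity) (norm_nonneg _), ← Real.rpow_mul hB0,
    one_div_mul_cancel hr.ne', Real.rpow_one]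
  rcases eq_or_ne u 0 with rfl | hu
  · have h0 : ∀ᵐ x, a x * |toLp N s p 0 x| ^ r = 0 := by
      rw [map_zero]
      filter_upwards [Lp.coeFn_zero ℝ (ENNReal.ofReal (critExp N s p))
        (volume : Measure (Space N))] with x hx
      rw [hx]; simp [Real.zero_rpow hr.ne']
    rw [integral_congr_ae h0]; simp; positivity
  · have hu0 : 0 < ‖u‖ := norm_pos_iff.2 hu
    have h1 := hC (‖u‖⁻¹ • u)
    have h2 : ‖‖u‖⁻¹ • u‖ = 1 := by
      rw [norm_smul, norm_inv, norm_norm, inv_mul_cancel₀ hu0.ne']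
    have h3 := hK (‖u‖⁻¹ • u)
    rw [h2, mul_one] at h3
    have h4 : ∫ x, a x * |toLp N s p (‖u‖⁻¹ • u) x| ^ r = (‖u‖⁻¹) ^ r * ∫ x, a x * |u x| ^ r := by
      rw [← integral_const_mul]
      refine integral_congr_ae ?_
      filter_upwards [coe_smul ‖u‖⁻¹ u] with x hx
      rw [hx, Pi.smul_apply, smul_eq_mul, abs_mul, abs_of_pos (by positivity : 0 < ‖u‖⁻¹),
        Real.mul_rpow (by positivity) (abs_nonneg _)]
      ring
    have h5 : ‖toLp N s p (‖u‖⁻¹ • u)‖ ^ critExp N s p ≤ K ^ critExp N s p :=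
      Real.rpow_le_rpow (norm_nonneg _) h3 (by linarith)
    have h6 : (‖u‖⁻¹) ^ r * ∫ x, a x * |u x| ^ r ≤ B := by
      rw [← h4, hB]
      refine h1.trans ?_
      gcongr
    rwa [Real.inv_rpow hu0.le, inv_mul_le_iff₀ (by positivity), mul_comm] at h6

theorem exists_clm_weight [Fact (1 ≤ ENNReal.ofReal r)] (hr : 0 < r) (hrm : r < critExp N s p)
    (hai : Integrable a volume) (hab : ∀ᵐ x, 0 ≤ a x ∧ a x ≤ c) :
    ∃ F : HomSobolev N s p →L[ℝ] Lp ℝ (ENNReal.ofReal r) (volume : Measure (Space N)),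
      (∀ u, F u =ᵐ[volume] fun x => a x ^ (1 / r) * u x) ∧
      ∀ u, ‖F u‖ ^ r = ∫ x, a x * |u x| ^ r := by
  obtain ⟨D, hD0, hD⟩ := exists_integral_weight_mul_le_rpow (s := s) (p := p) hr hrm hai hab
  have hpow : ∀ᵐ x, ∀ t : ℝ, |a x ^ (1 / r) * t| ^ r = a x * |t| ^ r := by
    filter_upwards [hab] with x hx t
    rw [abs_mul, abs_of_nonneg (Real.rpow_nonneg hx.1 _),
      Real.mul_rpow (Real.rpow_nonneg hx.1 _) (abs_nonneg _), ← Real.rpow_mul hx.1,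
      one_div_mul_cancel hr.ne', Real.rpow_one]
  have hmeas : ∀ u : HomSobolev N s p,
      AEStronglyMeasurable (fun x => a x ^ (1 / r) * u x) volume := fun u =>
    ((hai.1.aemeasurable.pow_const _).mul
      (Lp.aestronglyMeasurable (toLp N s p u)).aemeasurable).aestronglyMeasurable
  obtain ⟨F, hF⟩ := exists_clm_toLp (μ := (volume : Measure (Space N))) hr
    (fun (u : HomSobolev N s p) x => a x ^ (1 / r) * u x)
    (fun u => by
      rw [← integrable_norm_rpow_iff (hmeas u) (by simpa using hr) ENNReal.ofReal_ne_top,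
        ENNReal.toReal_ofReal hr.le]
      refine (integrable_weight_mul hr hrm hai hab u).congr ?_
      filter_upwards [hpow] with x hx using (hx _).symm)
    (fun u v => by
      filter_upwards [coe_add u v] with x hx
      rw [hx, Pi.add_apply, Pi.add_apply, mul_add])
    (fun k u => by
      filter_upwards [coe_smul k u] with x hx
      rw [hx, Pi.smul_apply, Pi.smul_apply, smul_eq_mul, smul_eq_mul, mul_left_comm])
    hD0 fun u => by
      refine le_trans (le_of_eq (integral_congr_ae ?_)) (hD u)
      filter_upwards [hpow] with x hx using hx _
  refine ⟨F, hF, fun u => ?_⟩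
  rw [norm_rpow_eq_integral hr]
  refine integral_congr_ae ?_
  filter_upwards [hpow, hF u] with x hx hx'
  rw [hx', hx]

/-- No mass concentrates or escapes to infinity: `a |u_j|^r` is at most a small multiple of
`|u_j|^{p_s^*}` plus a multiple of the integrable function `a`. -/
theorem tendsto_integral_weight_mul (hr : 0 < r) (hrm : r < critExp N s p)
    (hai : Integrable a volume) (hab : ∀ᵐ x, 0 ≤ a x ∧ a x ≤ c) {u : ℕ → HomSobolev N s p}
    {w : HomSobolev N s p} {M : ℝ} (hM : ∀ j, ‖toLp N s p (u j)‖ ≤ M)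
    (hlim : ∀ᵐ x, Tendsto (fun j => u j x) atTop (𝓝 (w x))) :
    Tendsto (fun j => ∫ x, a x * |u j x| ^ r) atTop (𝓝 (∫ x, a x * |w x| ^ r)) := by
  have hm := one_lt_critExp N s p
  have hi := integrable_weight_mul hr hrm hai hab
  have hc : 0 ≤ c := by
    obtain ⟨x, hx⟩ := hab.exists
    exact hx.1.trans hx.2
  rw [← tendsto_sub_nhds_zero_iff]
  simp_rw [← fun j => integral_sub (hi (u j)) (hi w)]
  refine tendsto_integral_zero_of_le_mul_add (k := fun j x => |u j x| ^ critExp N s p)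
    (M := M ^ critExp N s p) (fun j => ((hi (u j)).sub (hi w)).1) ?_
    (fun j => integrable_abs_rpow_critExp (u j)) (fun j => ae_of_all _ fun x => by positivity)
    (fun j => ?_) fun ε hε => ?_
  · filter_upwards [hlim] with x hx
    have h := ((hx.abs.rpow_const (Or.inr hr.le)).const_mul (a x)).sub_const (a x * |w x| ^ r)
    simpa using h
  · rw [← norm_toLp_rpow]
    exact Real.rpow_le_rpow (norm_nonneg _) (hM j) (by linarith)
  · obtain ⟨C, hC0, hC⟩ := exists_rpow_le_add hr hrm (ε := ε / (c + 1)) (by positivity)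
    refine ⟨fun x => C * a x + a x * |w x| ^ r, (hai.const_mul C).add (hi w), fun j => ?_⟩
    filter_upwards [hab] with x hx
    have h1 := weight_le_add hx.1 hx.2 (by positivity) (abs_nonneg _) (hC |u j x| (abs_nonneg _))
    have h2 : ε / (c + 1) * c ≤ ε := by
      rw [div_mul_eq_mul_div, div_le_iff₀ (by positivity)]; nlinarith
    have h3 := mul_le_mul_of_nonneg_right h2 (by positivity : 0 ≤ |u j x| ^ critExp N s p)
    have h4 : 0 ≤ a x * |u j x| ^ r := mul_nonneg hx.1 (by positivity)
    have h5 : 0 ≤ a x * |w x| ^ r := mul_nonneg hx.1 (by positivity)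
    rw [abs_le]; constructor <;> linarith [mul_nonneg hC0 hx.1]

end Weight

end Operators

/-- These two consequences are all that is used of the decay. Integrability comes from comparison
with `(1 + ‖x‖) ^ (-(N + α))`. -/
theorem integrable_and_le_of_le_div {N : ℕ} {a : Space N → ℝ} {α ca : ℝ}
    (ha : AEMeasurable a volume) (hα : 0 < α) (hca : 0 ≤ ca)
    (hbd : ∀ᵐ x, 0 ≤ a x ∧ a x ≤ ca / (1 + ‖x‖ ^ ((N : ℝ) + α))) :
    Integrable a volume ∧ ∀ᵐ x, 0 ≤ a x ∧ a x ≤ ca := by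
  have hκ : 0 < (N : ℝ) + α := by positivity
  constructor
  · refine ((integrable_one_add_norm (E := Space N) (μ := volume) (r := (N : ℝ) + α)
      (by simpa using hα)).const_mul (ca * 2 ^ ((N : ℝ) + α))).mono' ha.aestronglyMeasurable ?_
    filter_upwards [hbd] with x hx
    rw [Real.norm_eq_abs, abs_of_nonneg hx.1]
    refine hx.2.trans ?_
    have ht : 0 ≤ ‖x‖ := norm_nonneg x
    have h1 : (1 + ‖x‖) ^ ((N : ℝ) + α) ≤ 2 ^ ((N : ℝ) + α) * (1 + ‖x‖ ^ ((N : ℝ) + α)) := by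
      rcases le_total ‖x‖ 1 with h | h
      · have h2 : (1 + ‖x‖) ^ ((N : ℝ) + α) ≤ 2 ^ ((N : ℝ) + α) :=
          Real.rpow_le_rpow (by positivity) (by linarith) hκ.le
        have h3 : 0 ≤ (2 : ℝ) ^ ((N : ℝ) + α) * ‖x‖ ^ ((N : ℝ) + α) := by positivity
        linarith
      · have h2 : (1 + ‖x‖) ^ ((N : ℝ) + α) ≤ (2 * ‖x‖) ^ ((N : ℝ) + α) :=
          Real.rpow_le_rpow (by positivity) (by linarith) hκ.le
        rw [Real.mul_rpow (by positivity) ht] at h2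
        have h3 : 0 ≤ (2 : ℝ) ^ ((N : ℝ) + α) := by positivity
        linarith
    rw [Real.rpow_neg (by positivity), ← div_eq_mul_inv,
      div_le_div_iff₀ (by positivity) (by positivity), mul_assoc]
    gcongr
  · filter_upwards [hbd] with x hx
    refine ⟨hx.1, hx.2.trans (div_le_self hca ?_)⟩
    have : 0 ≤ ‖x‖ ^ ((N : ℝ) + α) := by positivity
    linarith

/-! ### The Palais-Smale condition -/

section PalaisSmale

variable {N : ℕ} {s p : ℝ} [hs : Fact (s ∈ Set.Ioo (0 : ℝ) 1)]
  [hp : Fact (p ∈ Set.Ioo 1 ((N : ℝ) / s))]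

theorem sobolevConst_nonneg : 0 ≤ sobolevConst N s p :=
  Real.iInf_nonneg fun u => by positivity

theorem sobolevConst_mul_le (u : HomSobolev N s p) :
    sobolevConst N s p * ‖toLp N s p u‖ ^ p ≤ ‖u‖ ^ p := by
  have hp0 := exp_pos N s p
  rcases eq_or_ne u 0 with rfl | hu
  · simp [Real.zero_rpow hp0.ne']
  · have h1 : 0 < ‖toLp N s p u‖ := by
      rw [norm_pos_iff]
      intro h
      exact hu (toLp_injective (h.trans (map_zero _).symm))
    rw [← le_div_iff₀ (by positivity)]
    exact ciInf_le ⟨0, by rintro _ ⟨v, rfl⟩; positivity⟩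
      (⟨u, hu⟩ : {u : HomSobolev N s p // u ≠ 0})

theorem one_div_sub_one_div_critExp (N : ℕ) (s p : ℝ) [hs : Fact (s ∈ Set.Ioo (0 : ℝ) 1)]
    [hp : Fact (p ∈ Set.Ioo 1 ((N : ℝ) / s))] : 1 / p - 1 / critExp N s p = s / N := by
  have h1 := exp_pos N s p
  have h2 := dim_pos N s p
  have h3 : (N : ℝ) - s * p ≠ 0 := (sub_pos.2 (mul_lt_dim N s p)).ne'
  rw [critExp]; field_simp; ring

/-- A limit `l` of both `‖v_j‖^p` and `|v_j|^{p_s^*}` either vanishes or is at least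
`S^{N/(sp)}`. -/
theorem eq_zero_or_sobolevConst_rpow_le {v : ℕ → HomSobolev N s p} {l : ℝ}
    (h1 : Tendsto (fun j => ‖v j‖ ^ p) atTop (𝓝 l))
    (h2 : Tendsto (fun j => ‖toLp N s p (v j)‖ ^ critExp N s p) atTop (𝓝 l)) :
    l = 0 ∨ sobolevConst N s p ^ ((N : ℝ) / (s * p)) ≤ l := by
  have hp0 := exp_pos N s p
  have hN := dim_pos N s p
  have hsp := mul_lt_dim N s p
  have hs0 := hs.out.1
  have hd : 0 < (N : ℝ) - s * p := sub_pos.2 hsp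
  have hm : 0 < critExp N s p := one_pos.trans (one_lt_critExp N s p)
  have hl : 0 ≤ l := ge_of_tendsto' h1 fun j => by positivity
  set S := sobolevConst N s p with hS
  have hS0 : 0 ≤ S := sobolevConst_nonneg
  set κ := critExp N s p / p with hκ
  have hκ0 : 0 < κ := by positivity
  have h3 : ∀ j, S ^ κ * ‖toLp N s p (v j)‖ ^ critExp N s p ≤ (‖v j‖ ^ p) ^ κ := fun j => by
    have h4 := Real.rpow_le_rpow (by positivity) (sobolevConst_mul_le (v j)) hκ0.le
    rwa [Real.mul_rpow hS0 (by positivity), ← Real.rpow_mul (norm_nonneg (toLp N s p (v j))),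
      hκ, mul_div_cancel₀ _ hp0.ne'] at h4
  have h4 : S ^ κ * l ≤ l ^ κ :=
    le_of_tendsto_of_tendsto' (h2.const_mul _) (h1.rpow_const (Or.inr hκ0.le)) h3
  rcases hl.eq_or_lt with h0 | h0
  · exact Or.inl h0.symm
  right
  have h5 : l ^ κ = l ^ (κ - 1) * l := by
    conv_rhs => rw [← Real.rpow_one l]
    rw [← Real.rpow_mul hl, one_mul, ← Real.rpow_add h0]; ring_nf
  rw [h5] at h4
  -- Dividing by `l > 0` leaves `S ^ κ ≤ l ^ (κ - 1)`; the exponent `(N - s * p) / (s * p)` is `1 /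
  -- (κ - 1)`.
  have h6 := Real.rpow_le_rpow (by positivity) (le_of_mul_le_mul_right h4 h0)
    (by positivity : 0 ≤ (N - s * p) / (s * p))
  have hκN : κ = N / (N - s * p) := by rw [hκ, critExp]; field_simp
  have hd' : (N : ℝ) - s * p ≠ 0 := hd.ne'
  rwa [← Real.rpow_mul hS0, ← Real.rpow_mul hl,
    show κ * ((N - s * p) / (s * p)) = N / (s * p) by
      rw [hκN, div_mul_div_cancel₀ hd'],
    show (κ - 1) * ((N - s * p) / (s * p)) = 1 by
      rw [hκN, div_sub_one hd', div_mul_div_cancel₀ hd', sub_sub_cancel, div_self (by positivity)],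
    Real.rpow_one] at h6

end PalaisSmale

/-! ### Real sequences attached to the energy -/

theorem bddAbove_of_rpow_le_add {p κ K : ℝ} (hp : 1 < p) (hκ : 0 < κ) {x : ℕ → ℝ}
    (h : ∀ᶠ j in atTop, κ * x j ^ p ≤ K + x j) (hx : ∀ j, 0 ≤ x j) :
    ∃ M, ∀ j, x j ≤ M := by
  obtain ⟨C, hC0, hC⟩ := exists_rpow_le_add one_pos hp (half_pos hκ)
  have h1 : ∀ᶠ j in atTop, x j ≤ K + 2 * C := by
    filter_upwards [h] with j hj
    have h2 := hC (x j) (hx j)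
    rw [Real.rpow_one] at h2
    linarith
  obtain ⟨M, hM⟩ := (isBoundedUnder_of_eventually_le h1).bddAbove_range
  exact ⟨M, fun j => hM ⟨j, rfl⟩⟩

/-- Sequences behaving like a Palais-Smale sequence of the energy are bounded: `x`, `A`, `B`, `G`
are the norm and the integrals in the energy `E`, and `d` is the derivative at the point itself. -/
theorem exists_bound_of_energy {p q m lam mu c k₀ : ℝ} (hp : 1 < p) (hpq : p < q) (hqm : q < m)
    (hlam : 0 ≤ lam) (hk₀ : 0 ≤ k₀) {x A B G E d ε : ℕ → ℝ} (hx : ∀ j, 0 ≤ x j) (hG : ∀ j, 0 ≤ G j)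
    (hE : ∀ j, E j = 1 / p * x j ^ p - lam / p * A j - mu / q * B j - 1 / m * G j)
    (hd : ∀ j, d j = x j ^ p - lam * A j - mu * B j - G j) (hdε : ∀ j, |d j| ≤ ε j * x j)
    (hA : ∀ η > 0, ∃ C, ∀ j, A j ≤ η * k₀ * G j + C)
    (hEc : Tendsto E atTop (𝓝 c)) (hε : Tendsto ε atTop (𝓝 0)) :
    ∃ M, ∀ j, x j ≤ M := by
  have hp0 : 0 < p := by linarith
  have hq0 : 0 < q := by linarith
  have hκ : 0 < 1 / p - 1 / q := sub_pos.2 (one_div_lt_one_div_of_lt hp0 hpq)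
  have hκ' : 0 < 1 / q - 1 / m := sub_pos.2 (one_div_lt_one_div_of_lt hq0 hqm)
  set k := 1 / p - 1 / q with hk
  set k' := 1 / q - 1 / m with hk'
  -- Chosen so that the share of `G` in `k * lam * A j` is at most `k' * G j`, the critical term
  -- available in `h7`.
  obtain ⟨C, hC⟩ := hA (k' / (k * (lam + 1) * (k₀ + 1))) (by positivity)
  refine bddAbove_of_rpow_le_add (K := c + 1 + k * (lam * C)) hp hκ ?_ hx
  filter_upwards [hEc.eventually (gt_mem_nhds (lt_add_one c)),
    hε.eventually (gt_mem_nhds one_pos)] with j hj1 hj2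
  have h4 : |d j| ≤ x j := (hdε j).trans (mul_le_of_le_one_left (hx j) hj2.le)
  have h6 : k * (lam * A j) ≤ k' * G j + k * (lam * C) := by
    have h7 : k * lam * (k' / (k * (lam + 1) * (k₀ + 1)) * k₀) ≤ k' := by
      have h8 : k * lam * (k' / (k * (lam + 1) * (k₀ + 1)) * k₀) =
          k' * (lam / (lam + 1)) * (k₀ / (k₀ + 1)) := by field_simp
      rw [h8]
      have h9 : lam / (lam + 1) ≤ 1 := by rw [div_le_one (by positivity)]; linarith
      have h10 : k₀ / (k₀ + 1) ≤ 1 := by rw [div_le_one (by positivity)]; linarith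
      calc _ ≤ k' * 1 * 1 := by gcongr
        _ = k' := by ring
    have h8 := mul_le_mul_of_nonneg_left (hC j) (by positivity : 0 ≤ k * lam)
    have h9 := mul_le_mul_of_nonneg_right h7 (hG j)
    linarith
  have h7 : E j - 1 / q * d j = k * x j ^ p - k * (lam * A j) + k' * G j := by
    rw [hE, hd, hk, hk']; ring
  have h8 : -(1 / q * d j) ≤ x j := by
    have h9 : 1 / q ≤ 1 := by rw [div_le_one hq0]; linarith
    have h11 : 1 / q * x j ≤ x j := mul_le_of_le_one_left (hx j) h9
    have h12 : 1 / q * -d j ≤ 1 / q * x j := by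
      gcongr; linarith [neg_abs_le (d j)]
    linarith
  linarith

/-- The defects `y` and `z` in the Brezis-Lieb splittings of `P` and `G` have the same limit. -/
theorem tendsto_defects_of_energy {p q m lam mu c P₀ A₀ B₀ G₀ : ℝ} (hpm : 1 / p - 1 / m ≠ 0)
    {P A B G E d y z : ℕ → ℝ}
    (hE : ∀ j, E j = 1 / p * P j - lam / p * A j - mu / q * B j - 1 / m * G j)
    (hd : ∀ j, d j = P j - lam * A j - mu * B j - G j)
    (hEc : Tendsto E atTop (𝓝 c)) (hdz : Tendsto d atTop (𝓝 0))
    (hP : Tendsto (fun j => P j - y j) atTop (𝓝 P₀)) (hA : Tendsto A atTop (𝓝 A₀))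
    (hB : Tendsto B atTop (𝓝 B₀)) (hG : Tendsto (fun j => G j - z j) atTop (𝓝 G₀))
    (h₀ : P₀ - lam * A₀ - mu * B₀ - G₀ = 0) {l : ℝ}
    (hl : c = 1 / p * P₀ - lam / p * A₀ - mu / q * B₀ - 1 / m * G₀ + (1 / p - 1 / m) * l) :
    Tendsto y atTop (𝓝 l) ∧ Tendsto z atTop (𝓝 l) := by
  -- The derivative identity along the sequence minus that at the limit leaves exactly `y - z`.
  have hyz : Tendsto (fun j => y j - z j) atTop (𝓝 0) := by
    have h1 := ((((hdz.sub hP).add (hA.const_mul lam)).add (hB.const_mul mu)).add hG)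
    refine (h1.congr fun j => ?_).trans_eq ?_
    · rw [hd]; ring
    · congr 1; linarith
  -- With `z` replaced by `y`, the energy identity determines the limit of `(1 / p - 1 / m) * y j`.
  have hyl : Tendsto y atTop (𝓝 l) := by
    have h1 := ((((hEc.sub (hP.const_mul (1 / p))).add (hA.const_mul (lam / p))).add
      (hB.const_mul (mu / q))).add (hG.const_mul (1 / m))).sub (hyz.const_mul (1 / m))
    refine ((h1.div_const (1 / p - 1 / m)).congr fun j => ?_).trans_eq ?_
    · rw [hE, div_eq_iff hpm]; ring
    · congr 1; rw [hl, div_eq_iff hpm]; ring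
  exact ⟨hyl, by simpa using hyl.sub hyz⟩

end FracSobolev

/-! ### The Palais–Smale condition for the energy -/

set_option maxHeartbeats 800000 in
open FracSobolev in
theorem lemma2p3 (N : ℕ) (s p : ℝ)
    [Fact (s ∈ Set.Ioo (0 : ℝ) 1)] [Fact (p ∈ Set.Ioo 1 ((N : ℝ) / s))]
    (q : ℝ) (hpq : p < q) (hq : q < FracSobolev.critExp N s p)
    (a b : FracSobolev.Space N → ℝ)
    (ha : AEMeasurable a volume) (hb : AEMeasurable b volume)
    (α β ca cb : ℝ) (hα : 0 < α) (hβ : 0 < β) (hca : 0 ≤ ca) (hcb : 0 ≤ cb)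
    (ha_bound : ∀ᵐ x, 0 ≤ a x ∧ a x ≤ ca / (1 + ‖x‖ ^ ((N : ℝ) + α)))
    (hb_bound : ∀ᵐ x, 0 ≤ b x ∧ b x ≤ cb / (1 + ‖x‖ ^ ((N : ℝ) + β)))
    (lam mu : ℝ) (hlam : 0 ≤ lam) (hmu : 0 ≤ mu)
    (c : ℝ) (hc : c < s / N * FracSobolev.sobolevConst N s p ^ ((N : ℝ) / (s * p))) :
    FracSobolev.PalaisSmale (FracSobolev.energy N s p q lam mu a b) c := by
  have hp1 : 1 < p := (Fact.out : p ∈ Set.Ioo 1 ((N : ℝ) / s)).1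
  have hs0 : 0 < s := (Fact.out : s ∈ Set.Ioo (0 : ℝ) 1).1
  have hp0 : 0 < p := by linarith
  have hq1 : 1 < q := by linarith
  have hq0 : 0 < q := by linarith
  have hN := dim_pos N s p
  have hsN := one_div_sub_one_div_critExp N s p
  have hpm := lt_critExp N s p
  set m := critExp N s p with hmdef
  have hm1 : 1 < m := by linarith
  have hm0 : 0 < m := by linarith
  have : Fact (1 ≤ ENNReal.ofReal p) := ⟨by simpa using ENNReal.ofReal_le_ofReal hp1.le⟩
  have : Fact (1 ≤ ENNReal.ofReal q) := ⟨by simpa using ENNReal.ofReal_le_ofReal hq1.le⟩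
  have : Fact (1 ≤ ENNReal.ofReal m) := ⟨by simpa using ENNReal.ofReal_le_ofReal hm1.le⟩
  obtain ⟨hai, hab⟩ := integrable_and_le_of_le_div ha hα hca ha_bound
  obtain ⟨hbi, hbb⟩ := integrable_and_le_of_le_div hb hβ hcb hb_bound
  obtain ⟨K, hK0, hK⟩ := exists_norm_toLp_le N s p
  obtain ⟨F, hFae, hF⟩ := exists_clm_diffQuot N s p
  obtain ⟨A, hAae, hA⟩ := exists_clm_weight (s := s) (p := p) hp0 hpm hai hab
  obtain ⟨B, hBae, hB⟩ := exists_clm_weight (s := s) (p := p) hq0 hq hbi hbb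
  let G : HomSobolev N s p →L[ℝ] CritLp N s p := (toLp N s p).mkContinuous K hK
  have hG : ∀ u, G u = toLp N s p u := fun u => rfl
  have hE : ∀ u, energy N s p q lam mu a b u =
      1 / p * ‖F u‖ ^ p - lam / p * ‖A u‖ ^ p - mu / q * ‖B u‖ ^ q - 1 / m * ‖G u‖ ^ m := by
    intro u
    rw [energy, integral_gagliardoIntegrand, hA, hB, hG, norm_toLp_rpow, hF]
  have hdE : ∀ u h, fderiv ℝ (energy N s p q lam mu a b) u h =
      powDeriv hp1 (F u) (F h) - lam * powDeriv hp1 (A u) (A h) - mu * powDeriv hq1 (B u) (B h)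
        - powDeriv hm1 (G u) (G h) := by
    intro u h
    have h1 := ((hasFDerivAt_norm_rpow_Lp hp1 (F u)).comp u F.hasFDerivAt).const_mul (1 / p)
    have h2 := ((hasFDerivAt_norm_rpow_Lp hp1 (A u)).comp u A.hasFDerivAt).const_mul (lam / p)
    have h3 := ((hasFDerivAt_norm_rpow_Lp hq1 (B u)).comp u B.hasFDerivAt).const_mul (mu / q)
    have h4 := ((hasFDerivAt_norm_rpow_Lp hm1 (G u)).comp u G.hasFDerivAt).const_mul (1 / m)
    have h5 := ((h1.sub h2).sub h3).sub h4
    have h6 : HasFDerivAt (energy N s p q lam mu a b) _ u :=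
      h5.congr_of_eventuallyEq (Eventually.of_forall fun v => hE v)
    rw [h6.fderiv]
    simp only [sub_apply, smul_apply,
      ContinuousLinearMap.comp_apply, smul_eq_mul]
    field_simp
  have hdEself : ∀ u, fderiv ℝ (energy N s p q lam mu a b) u u =
      ‖F u‖ ^ p - lam * ‖A u‖ ^ p - mu * ‖B u‖ ^ q - ‖G u‖ ^ m := fun u => by
    rw [hdE, powDeriv_self, powDeriv_self, powDeriv_self, powDeriv_self]
  have hle : ∀ u h, |fderiv ℝ (energy N s p q lam mu a b) u h| ≤
      ‖fderiv ℝ (energy N s p q lam mu a b) u‖ * ‖h‖ := fun u h =>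
    (Real.norm_eq_abs _).symm.trans_le (ContinuousLinearMap.le_opNorm _ _)
  intro u hEu hdu
  have hdn : Tendsto (fun j => ‖fderiv ℝ (energy N s p q lam mu a b) (u j)‖) atTop (𝓝 0) := by
    simpa using hdu.norm
  obtain ⟨M, hM⟩ : ∃ M, ∀ j, ‖u j‖ ≤ M := by
    refine exists_bound_of_energy (mu := mu) (A := fun j => ‖A (u j)‖ ^ p)
      (B := fun j => ‖B (u j)‖ ^ q) (G := fun j => ‖G (u j)‖ ^ m) hp1 hpq hq hlam hca (fun j => norm_nonneg (u j))
      (fun j => by positivity) (fun j => (hE (u j)).trans (by rw [hF]))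
      (fun j => (hdEself (u j)).trans (by rw [hF])) (fun j => hle (u j) (u j)) (fun η hη => ?_)
      hEu hdn
    obtain ⟨C, -, hC⟩ := exists_integral_weight_mul_le (s := s) (p := p) hp0 hpm hai hab hη
    exact ⟨C, fun j => (hA (u j)).trans_le (hC (u j))⟩
  obtain ⟨φ, hφ, w, hw⟩ := exists_subseq_tendsto_ae_homSobolev u hM
  refine ⟨φ, hφ, w, ?_⟩
  set v : ℕ → HomSobolev N s p := fun j => u (φ j) with hv
  have hEv : Tendsto (fun j => energy N s p q lam mu a b (v j)) atTop (𝓝 c) :=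
    hEu.comp hφ.tendsto_atTop
  have hdv : Tendsto (fun j => ‖fderiv ℝ (energy N s p q lam mu a b) (v j)‖) atTop (𝓝 0) :=
    hdn.comp hφ.tendsto_atTop
  have hbdd : ∀ {X : Type} [MeasurableSpace X] {μ : Measure X} {r : ℝ}
      [Fact (1 ≤ ENNReal.ofReal r)] (T : HomSobolev N s p →L[ℝ] Lp ℝ (ENNReal.ofReal r) μ) (j : ℕ),
      ‖T (v j)‖ ≤ ‖T‖ * M := fun T j =>
    (T.le_opNorm _).trans (mul_le_mul_of_nonneg_left (hM _) (norm_nonneg _))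
  have hFlim : ∀ᵐ z, Tendsto (fun j => F (v j) z) atTop (𝓝 (F w z)) := by
    filter_upwards [ae_tendsto_diffQuot (s := s) (p := p) hw, hFae w,
      ae_all_iff.2 fun j => hFae (v j)] with z h1 h2 h3
    rw [h2]; exact h1.congr fun j => (h3 j).symm
  have hAlim : ∀ᵐ x, Tendsto (fun j => A (v j) x) atTop (𝓝 (A w x)) := by
    filter_upwards [hw, hAae w, ae_all_iff.2 fun j => hAae (v j)] with z h1 h2 h3
    rw [h2]; exact (h1.const_mul _).congr fun j => (h3 j).symm
  have hBlim : ∀ᵐ x, Tendsto (fun j => B (v j) x) atTop (𝓝 (B w x)) := by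
    filter_upwards [hw, hBae w, ae_all_iff.2 fun j => hBae (v j)] with z h1 h2 h3
    rw [h2]; exact (h1.const_mul _).congr fun j => (h3 j).symm
  -- Testing the derivative against `w` alone suffices; almost everywhere convergence and
  -- boundedness pass to the limit.
  have hcrit : fderiv ℝ (energy N s p q lam mu a b) w w = 0 := by
    have h1 : Tendsto (fun j => fderiv ℝ (energy N s p q lam mu a b) (v j) w) atTop
        (𝓝 (fderiv ℝ (energy N s p q lam mu a b) w w)) := by
      simp_rw [hdE]
      exact (((tendsto_powDeriv hp1 (hbdd F) hFlim _).sub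
        ((tendsto_powDeriv hp1 (hbdd A) hAlim _).const_mul _)).sub
        ((tendsto_powDeriv hq1 (hbdd B) hBlim _).const_mul _)).sub
        (tendsto_powDeriv hm1 (hbdd G) hw _)
    refine tendsto_nhds_unique h1 (squeeze_zero_norm (fun j => hle (v j) w) ?_)
    simpa using hdv.mul_const ‖w‖
  have hself : Tendsto (fun j => fderiv ℝ (energy N s p q lam mu a b) (v j) (v j)) atTop (𝓝 0) := by
    refine squeeze_zero_norm (fun j => (hle (v j) (v j)).trans
      (mul_le_mul_of_nonneg_left (hM _) (norm_nonneg _))) ?_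
    simpa using hdv.mul_const M
  have hAn : Tendsto (fun j => ‖A (v j)‖ ^ p) atTop (𝓝 (‖A w‖ ^ p)) := by
    simp_rw [hA]
    exact tendsto_integral_weight_mul hp0 hpm hai hab (hbdd G) hw
  have hBn : Tendsto (fun j => ‖B (v j)‖ ^ q) atTop (𝓝 (‖B w‖ ^ q)) := by
    simp_rw [hB]
    exact tendsto_integral_weight_mul hq0 hq hbi hbb (hbdd G) hw
  have hFn : Tendsto (fun j => ‖F (v j)‖ ^ p - ‖v j - w‖ ^ p) atTop (𝓝 (‖F w‖ ^ p)) :=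
    (tendsto_norm_rpow_sub_norm_sub_rpow hp1 (hbdd F) hFlim).congr fun j => by
      rw [← map_sub, hF (v j - w)]
  have hGn : Tendsto (fun j => ‖G (v j)‖ ^ m - ‖toLp N s p (v j - w)‖ ^ m) atTop
      (𝓝 (‖G w‖ ^ m)) :=
    (tendsto_norm_rpow_sub_norm_sub_rpow hm1 (hbdd G) hw).congr fun j => by
      rw [map_sub, hG]
  have hd0 : 0 < 1 / p - 1 / m := by rw [hsN]; positivity
  -- The energy left over by `w`, in units of `1 / p - 1 / m = s / N`.
  set l : ℝ := (c - energy N s p q lam mu a b w) / (1 / p - 1 / m) with hl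
  obtain ⟨hyl, hzl⟩ := tendsto_defects_of_energy hd0.ne' (fun j => hE (v j))
    (fun j => hdEself (v j)) hEv hself hFn hAn hBn hGn ((hdEself w).symm.trans hcrit)
    (show c = _ + (1 / p - 1 / m) * l by
      rw [← hE w, hl, mul_div_cancel₀ _ hd0.ne', add_sub_cancel])
  -- Subtracting `E'(w)w / p = 0` removes the seminorm and the `a`-term; the remaining coefficients
  -- are nonnegative because `q` and `m` exceed `p`.
  have hEw : 0 ≤ energy N s p q lam mu a b w := by
    have h1 : energy N s p q lam mu a b w = mu * (1 / p - 1 / q) * ‖B w‖ ^ q +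
        (1 / p - 1 / m) * ‖G w‖ ^ m := by
      have h2 := hdEself w
      rw [hcrit] at h2
      rw [hE]
      linear_combination (-1 / p) * h2
    rw [h1]
    have h2 : 0 ≤ 1 / p - 1 / q := (sub_pos.2 (one_div_lt_one_div_of_lt hp0 hpq)).le
    have h3 := hd0.le
    positivity
  have hl0 : l = 0 := by
    refine (eq_zero_or_sobolevConst_rpow_le hyl hzl).resolve_right fun h => ?_
    have h1 : (1 / p - 1 / m) * l ≤ c := by
      rw [hl, mul_div_cancel₀ _ hd0.ne']; linarith
    have h2 := mul_le_mul_of_nonneg_left h hd0.le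
    rw [hsN] at h1 h2
    linarith
  rw [hl0] at hyl
  rw [tendsto_iff_norm_sub_tendsto_zero]
  have h1 := hyl.rpow_const (Or.inr (by positivity) : (0 : ℝ) ≠ 0 ∨ 0 ≤ 1 / p)
  rw [Real.zero_rpow (by positivity)] at h1
  refine h1.congr fun j => ?_
  rw [← Real.rpow_mul (norm_nonneg _), mul_one_div_cancel hp0.ne', Real.rpow_one]

end
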